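/- Let $X$ be a finite-dimensional real normed space with $\dim X\ge 2$, with dual space $X^*$ and dual norm $\|\cdot\|_*$. Let $\Omega\subset X$ be open and let $F:\mathbb{R}\times\Omega\times X^*\to\mathbb{R}$ be continuous. Assume that (A) $F(0,x,0)\le 0$ for every $x\in\Omega$; (B) for every compact set $K\subset\Omega$ there exist constants $\alpha_K,M_K>0$ such that $F(r,x,x^*)>0$ for all $x\in K$, $r\in[0,\alpha_K]$ and $x^*\in X^*$ with $\|x^*\|_*\ge M_K$. Then for every $\varepsilon>0$ there exists a continuous function $u:\overline{\Omega}\to\mathbb{R}$ with $u\ge 0$ and $|u|\le\varepsilon$ on $\overline{\Omega}$ that is an almost classical solution of $F(u(x),x,Du(x))=0$ on $\Omega$ with Dirichlet condition $u=0$ on $\partial\Omega$, that is: (i) $u=0$ on $\partial\Omega$; (ii) $u$ is differentiable on $\Omega$ and $F(u(x),x,Du(x))\le 0$ for every $x\in\Omega$; (iii) $F(u(x),x,Du(x))=0$ for almost every $x\in\Omega$ (with respect to Lebesgue measure on $X$). Moreover, the extension $\tilde u$ of $u$ defined by $\tilde u=0$ on $X\setminus\Omega$ is differentiable on $X$. 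-/

import Mathlib

open MeasureTheory Set

/-- Almost classical solutions of the first-order equation `F (u x, x, D u x) = 0` on the open
set `Ω` with Dirichlet condition `u = u₀` on the boundary `∂Ω = frontier Ω`.

The equation is given by `F : ℝ × Ω × X* → ℝ`, the boundary datum by `u₀ : ∂Ω → ℝ` and the solution
by `u : closure Ω → ℝ`; they are represented by total functions, and only the values on these sets
matter (for the derivative of `u` at points of `Ω` because `Ω` is open). The measure `μ` is
meant to be a Lebesgue (additive Haar) measure on `X`; all of them have the same null sets. -/
structure IsAlmostClassicalSolution {X : Type*} [NormedAddCommGroup X] [NormedSpace ℝ X]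
    [MeasurableSpace X] (μ : Measure X) (Ω : Set X) (F : ℝ → X → (X →L[ℝ] ℝ) → ℝ)
    (u₀ : X → ℝ) (u : X → ℝ) : Prop where
  continuousOn : ContinuousOn u (closure Ω)
  boundary : ∀ x ∈ frontier Ω, u x = u₀ x
  differentiableAt : ∀ x ∈ Ω, DifferentiableAt ℝ u x
  subsolution : ∀ x ∈ Ω, F (u x) x (fderiv ℝ u x) ≤ 0
  ae_eq_zero : ∀ᵐ x ∂μ, x ∈ Ω → F (u x) x (fderiv ℝ u x) = 0

/-! Start from the subsolution `0` and add, infinitely often, small nonnegative compactly supported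
sawtooth functions that keep `F ≤ 0`. As long as `F < 0` near a point, the gradient there is to be
moved by a step of definite size, yet the gradients must converge at every point of `Ω`, although
their steps need not be summable. Only the direction of a step can be prescribed: the sawtooth
decides its sign and length.

A game in a Euclidean copy `V` of the dual space resolves this. The current gradient `p` moves
orthogonally to `p - c` for a suitable centre `c`, which is possible because the dimension is at
least 2. Such a move never brings `p` closer to `c`. With one fixed centre this is not enough for
convergence, so a hierarchy is used: base points `b i`, with `p` always within `d i` of `b i`, and
centres obtained from one another by reflection. If `p` is at least as far as `b i` from centre `i +
1`, the parallelogram identity makes its squared distance to centre `i` exceed that of `b i` by at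
least `‖p - b i‖ ^ 2 / 2`. Escaping from `b i` by `d i` is therefore paid for by a fixed gain, and
bounded plays allow boundedly many escapes at each level. Hence bounded plays converge
(`IsPlay.cauchySeq`), and a long enough block of moves at level `j` contains a move shorter than `2
* d j` (`exists_short_step`).

Coercivity of `F` bounds the gradients of subsolutions of size at most `φ`, so the play at every
point of `Ω` is bounded and the gradients converge. Each perturbation is tiny compared with the
scales on which earlier stages are nearly linear, so the limit is differentiable with the limit
gradient (`hasFDerivAt_of_scales`). By continuity `F ≤ 0` in the limit. If `F < 0` at a generic
point, Borel–Cantelli makes all late steps there at least `2 * d j` long (`exists_perturbation`,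
`IsRun.ae_eventually_long_step`), contradicting the short move. Finally `φ` is bounded by the
squared distance to the complement, which gives derivative zero outside `Ω`. -/

/-! ### The orthogonal-move game and the convergence of its bounded plays -/

section Game

variable {V : Type*} [NormedAddCommGroup V]

/-- The base points from index `l` on are moved to `p`. -/
def resetFrom (b : ℕ → V) (l : ℕ) (p : V) : ℕ → V := fun i => if i < l then b i else p

/-- The first index that is either above `J` or whose base point is at distance at least `d`
from `p`. -/
noncomputable def exitIndex (d : ℕ → ℝ) (J : ℕ) (b : ℕ → V) (p : V) : ℕ :=
  sInf {j | J < j ∨ d j ≤ ‖p - b j‖}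

/-- The base points after a move to `p`. -/
noncomputable def update (d : ℕ → ℝ) (J : ℕ) (b : ℕ → V) (p : V) : ℕ → V :=
  resetFrom b (exitIndex d J b p) p

lemma norm_resetFrom_le {b : ℕ → V} {R : ℝ} (hb : ∀ i, ‖b i‖ ≤ R) {p : V} (hp : ‖p‖ ≤ R)
    (l i : ℕ) : ‖resetFrom b l p i‖ ≤ R := by
  unfold resetFrom
  split_ifs
  exacts [hb i, hp]

lemma exitIndex_le (d : ℕ → ℝ) (J : ℕ) (b : ℕ → V) (p : V) : exitIndex d J b p ≤ J + 1 :=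
  Nat.sInf_le (Or.inl (Nat.lt_succ_self J))

lemma exitIndex_spec (d : ℕ → ℝ) (J : ℕ) (b : ℕ → V) (p : V) :
    J < exitIndex d J b p ∨ d (exitIndex d J b p) ≤ ‖p - b (exitIndex d J b p)‖ :=
  Nat.sInf_mem (s := {j | J < j ∨ d j ≤ ‖p - b j‖}) ⟨J + 1, Or.inl (Nat.lt_succ_self J)⟩

lemma lt_of_lt_exitIndex {d : ℕ → ℝ} {J : ℕ} {b : ℕ → V} {p : V} {i : ℕ}
    (h : i < exitIndex d J b p) : ‖p - b i‖ < d i := by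
  have := Nat.notMem_of_lt_sInf h
  simp only [mem_ofPred_eq, not_or, not_le] at this
  exact this.2

variable [InnerProductSpace ℝ V]

/-- The centres attached to a sequence of base points: each centre is the reflection of the
base point through the previous centre. -/
def gameCenter (b : ℕ → V) : ℕ → V
  | 0 => 0
  | i + 1 => (2 : ℝ) • gameCenter b i - b i

/-- A play of the game: each move is orthogonal to the direction of the active centre. -/
structure IsPlay (d : ℕ → ℝ) (J : ℕ → ℕ) (p : ℕ → V) (b : ℕ → ℕ → V) : Prop where
  init : b 0 = fun _ => p 0
  orth : ∀ n, inner ℝ (p (n + 1) - p n) (p n - gameCenter (b n) (J n + 1)) = 0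
  next : ∀ n, b (n + 1) = update d (J n) (b n) (p (n + 1))

lemma gameCenter_congr {b b' : ℕ → V} {i : ℕ} (h : ∀ k < i, b k = b' k) :
    gameCenter b i = gameCenter b' i := by
  induction i with
  | zero => rfl
  | succ i ih =>
    simp only [gameCenter]
    rw [ih fun k hk => h k (hk.trans (Nat.lt_succ_self i)), h i (Nat.lt_succ_self i)]

lemma gameCenter_resetFrom (b : ℕ → V) {l i : ℕ} (p : V) (h : i ≤ l) :
    gameCenter (resetFrom b l p) i = gameCenter b i :=
  gameCenter_congr fun k hk => by simp [resetFrom, hk.trans_le h]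

lemma norm_gameCenter_le {b : ℕ → V} {R : ℝ} (hb : ∀ i, ‖b i‖ ≤ R) (i : ℕ) :
    ‖gameCenter b i‖ ≤ 3 ^ i * R := by
  have hR : 0 ≤ R := (norm_nonneg _).trans (hb 0)
  induction i with
  | zero => simpa [gameCenter] using hR
  | succ i ih =>
    have h1 : ‖(2 : ℝ) • gameCenter b i‖ = 2 * ‖gameCenter b i‖ := by simp [norm_smul]
    have h2 := norm_sub_le ((2 : ℝ) • gameCenter b i) (b i)
    have h3 : R ≤ 3 ^ i * R := le_mul_of_one_le_left hR (one_le_pow₀ (by norm_num))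
    simp only [gameCenter]
    rw [pow_succ]
    linarith [hb i]

/-- The identity that transfers distance gains from one centre to the previous one. -/
lemma norm_sub_sq_gain (a b c : V) :
    ‖a - c‖ ^ 2 - ‖b - c‖ ^ 2 =
      (‖a - ((2 : ℝ) • c - b)‖ ^ 2 - ‖b - ((2 : ℝ) • c - b)‖ ^ 2) / 2 + ‖a - b‖ ^ 2 / 2 := by
  have h1 : a - c = (a - b) + (b - c) := by abel
  have h2 : a - ((2 : ℝ) • c - b) = (a - b) + (2 : ℝ) • (b - c) := by module
  have h3 : b - ((2 : ℝ) • c - b) = (2 : ℝ) • (b - c) := by module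
  rw [h1, h2, h3, norm_add_sq_real, norm_add_sq_real, inner_smul_right]
  ring

/-- The point `2c - b` is the next centre: not having come closer to it forces a quantitative gain
of distance from `c`. -/
lemma gain_of_le {a b c : V}
    (h : ‖b - ((2 : ℝ) • c - b)‖ ≤ ‖a - ((2 : ℝ) • c - b)‖) :
    ‖b - c‖ ^ 2 + ‖a - b‖ ^ 2 / 2 ≤ ‖a - c‖ ^ 2 := by
  have h1 := norm_sub_sq_gain a b c
  have h2 := pow_le_pow_left₀ (norm_nonneg _) h 2
  linarith

namespace IsPlay

variable {d : ℕ → ℝ} {J : ℕ → ℕ} {p : ℕ → V} {b : ℕ → ℕ → V}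

/-- The exit index is at most `J n + 1`, so every move resets all base points above the level;
monotonicity of `J` carries this to the next level. -/
lemma base_eq_of_lt (h : IsPlay d J p b) (hJ : Monotone J) (n : ℕ) {i : ℕ} (hi : J n < i) :
    b n i = p n := by
  cases n with
  | zero => simp [h.init]
  | succ n =>
    have h1 : exitIndex d (J n) (b n) (p (n + 1)) ≤ i :=
      (exitIndex_le _ _ _ _).trans ((Nat.succ_le_succ (hJ n.le_succ)).trans hi)
    rw [h.next, update, resetFrom, if_neg (not_lt.2 h1)]

lemma norm_sub_base_lt (h : IsPlay d J p b) (hd : ∀ i, 0 < d i) (n i : ℕ) :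
    ‖p n - b n i‖ < d i := by
  cases n with
  | zero => simpa [h.init] using hd i
  | succ n =>
    rw [h.next, update, resetFrom]
    split_ifs with hi
    · exact lt_of_lt_exitIndex hi
    · simpa using hd i

lemma norm_base_le (h : IsPlay d J p b) {R : ℝ} (hR : ∀ n, ‖p n‖ ≤ R) (n i : ℕ) :
    ‖b n i‖ ≤ R := by
  induction n generalizing i with
  | zero => simpa [h.init] using hR 0
  | succ n ih =>
    rw [h.next]
    exact norm_resetFrom_le ih (hR _) _ _

/-- Downward induction over the centres. At the active centre, Pythagoras applies because the move
is orthogonal; from centre `k + 1` to centre `k`, the ordering of the base points feeds the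
reflection identity. -/
lemma key_aux (h : IsPlay d J p b) (hJ : Monotone J) (n : ℕ)
    (hn : ∀ i, ‖b n i - gameCenter (b n) (i + 1)‖ ≤ ‖b n (i + 1) - gameCenter (b n) (i + 1)‖)
    {i : ℕ} (hi : i ≤ J n + 1) :
    ‖b n i - gameCenter (b n) i‖ ≤ ‖p (n + 1) - gameCenter (b n) i‖ := by
  induction hi using Nat.decreasingInduction with
  | self =>
    rw [h.base_eq_of_lt hJ n (Nat.lt_succ_self _)]
    have h1 : p (n + 1) - gameCenter (b n) (J n + 1)
        = (p (n + 1) - p n) + (p n - gameCenter (b n) (J n + 1)) := by abel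
    have h2 : ‖p (n + 1) - gameCenter (b n) (J n + 1)‖ ^ 2
        = ‖p (n + 1) - p n‖ ^ 2 + ‖p n - gameCenter (b n) (J n + 1)‖ ^ 2 := by
      rw [h1, norm_add_sq_real, h.orth]; ring
    exact (pow_le_pow_iff_left₀ (norm_nonneg _) (norm_nonneg _) two_ne_zero).1
      (h2 ▸ le_add_of_nonneg_left (sq_nonneg _))
  | of_succ k hk ih =>
    have h1 := gain_of_le (a := p (n + 1)) (b := b n k) (c := gameCenter (b n) k)
      ((hn k).trans ih)
    exact (pow_le_pow_iff_left₀ (norm_nonneg _) (norm_nonneg _) two_ne_zero).1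
      ((le_add_of_nonneg_right (by positivity)).trans h1)

/-- This invariant links consecutive levels. After a reset at `l`, only the comparison at `i + 1 =
l` is new: its centre depends on untouched base points, and `key_aux` compares the new position with
it. -/
lemma base_mono (h : IsPlay d J p b) (hJ : Monotone J) (n i : ℕ) :
    ‖b n i - gameCenter (b n) (i + 1)‖ ≤ ‖b n (i + 1) - gameCenter (b n) (i + 1)‖ := by
  induction n generalizing i with
  | zero => simp [h.init]
  | succ n ih =>
    rw [h.next, update]
    set l := exitIndex d (J n) (b n) (p (n + 1)) with hl
    rcases lt_or_ge i l with hi | hi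
    · rw [gameCenter_resetFrom _ _ hi]
      rcases lt_or_ge (i + 1) l with hi' | hi'
      · simpa [resetFrom, hi, hi'] using ih i
      · have : i + 1 = l := le_antisymm hi hi'
        simp only [resetFrom, hi, if_true, not_lt.2 hi', if_false]
        exact (ih i).trans (h.key_aux hJ n ih (this ▸ exitIndex_le _ _ _ _))
    · simp [resetFrom, not_lt.2 hi, not_lt.2 (hi.trans i.le_succ)]

lemma gain (h : IsPlay d J p b) (hJ : Monotone J) (n : ℕ) {i : ℕ} (hi : i ≤ J n) :
    ‖b n i - gameCenter (b n) i‖ ^ 2 + ‖p (n + 1) - b n i‖ ^ 2 / 2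
      ≤ ‖p (n + 1) - gameCenter (b n) i‖ ^ 2 :=
  gain_of_le ((h.base_mono hJ n i).trans
    (h.key_aux hJ n (h.base_mono hJ n) (Nat.succ_le_succ hi)))

end IsPlay

/-- A potential that depends on the base points up to index `j` only, is bounded on bounded
sequences, and grows by at least one with each reset at an index `l ≤ j`. -/
lemma exists_potential (V : Type*) [NormedAddCommGroup V] [InnerProductSpace ℝ V]
    (d : ℕ → ℝ) (hd : ∀ i, 0 < d i) (R : ℝ) (j : ℕ) :
    ∃ (Φ : (ℕ → V) → ℝ) (C : ℝ),
      (∀ b, (∀ i, ‖b i‖ ≤ R) → 0 ≤ Φ b ∧ Φ b ≤ C) ∧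
      (∀ b b', (∀ i ≤ j, b i = b' i) → Φ b = Φ b') ∧
      (∀ b p l, (∀ i, ‖b i‖ ≤ R) → ‖p‖ ≤ R → l ≤ j →
        ‖b l - gameCenter b l‖ ^ 2 + d l ^ 2 / 2 ≤ ‖p - gameCenter b l‖ ^ 2 →
        Φ b + 1 ≤ Φ (resetFrom b l p)) := by
  have hbd : ∀ (j : ℕ) (b : ℕ → V), (∀ i, ‖b i‖ ≤ R) →
      2 / d j ^ 2 * ‖b j - gameCenter b j‖ ^ 2 ≤ 2 / d j ^ 2 * (R + 3 ^ j * R) ^ 2 := by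
    intro j b hb
    have h1 := (norm_sub_le (b j) (gameCenter b j)).trans (add_le_add (hb j) (norm_gameCenter_le hb j))
    gcongr
  -- The weight `2 / d j ^ 2` turns the gain `d j ^ 2 / 2` into exactly one.
  have hgain : ∀ (j : ℕ) (b : ℕ → V) (p : V),
      ‖b j - gameCenter b j‖ ^ 2 + d j ^ 2 / 2 ≤ ‖p - gameCenter b j‖ ^ 2 →
      2 / d j ^ 2 * ‖b j - gameCenter b j‖ ^ 2 + 1
        ≤ 2 / d j ^ 2 * ‖resetFrom b j p j - gameCenter (resetFrom b j p) j‖ ^ 2 := by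
    intro j b p h
    have h0 := hd j
    rw [gameCenter_resetFrom b p le_rfl]
    simp only [resetFrom, lt_irrefl, if_false]
    have := mul_le_mul_of_nonneg_left h (show 0 ≤ 2 / d j ^ 2 by positivity)
    refine le_trans (le_of_eq ?_) this
    field_simp
  induction j with
  | zero =>
    refine ⟨fun b => 2 / d 0 ^ 2 * ‖b 0 - gameCenter b 0‖ ^ 2, _,
      fun b hb => ⟨by positivity, hbd 0 b hb⟩, fun b b' h => ?_, fun b p l hb hp hl h => ?_⟩
    · simp [h 0 le_rfl, gameCenter]
    · obtain rfl : l = 0 := by omega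
      exact hgain 0 b p h
  | succ j ih =>
    obtain ⟨Φ, C, h1, h2, h3⟩ := ih
    -- A reset at an index `≤ j` can destroy at most `B` of the new term; multiplying the old
    -- potential by `1 + B` compensates for this and still leaves a gain of one.
    set B := 2 / d (j + 1) ^ 2 * (R + 3 ^ (j + 1) * R) ^ 2 with hB
    have hB0 : 0 ≤ B := by positivity
    refine ⟨fun b => (1 + B) * Φ b + 2 / d (j + 1) ^ 2 * ‖b (j + 1) - gameCenter b (j + 1)‖ ^ 2,
      (1 + B) * C + B, fun b hb => ⟨?_, ?_⟩, fun b b' h => ?_, fun b p l hb hp hl h => ?_⟩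
    · have := (h1 b hb).1
      positivity
    · have := mul_le_mul_of_nonneg_left (h1 b hb).2 (show 0 ≤ 1 + B by positivity)
      linarith [hbd (j + 1) b hb]
    · simp only
      rw [h2 b b' fun i hi => h i (hi.trans j.le_succ), h (j + 1) le_rfl,
        gameCenter_congr fun k hk => h k hk.le]
    · simp only
      rcases Nat.lt_or_ge j l with hjl | hjl
      · obtain rfl : l = j + 1 := by omega
        rw [← h2 b (resetFrom b (j + 1) p) fun i hi => by simp [resetFrom, Nat.lt_succ_of_le hi]]
        linarith [hgain (j + 1) b p h]
      · have h4 := mul_le_mul_of_nonneg_left (h3 b p l hb hp hjl h)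
          (show 0 ≤ 1 + B by positivity)
        have h5 := hbd (j + 1) b hb
        have h6 : 0 ≤ 2 / d (j + 1) ^ 2 * ‖resetFrom b l p (j + 1)
          - gameCenter (resetFrom b l p) (j + 1)‖ ^ 2 := by positivity
        linarith

/-- Along a bounded play, the resets at indices `≤ j` are bounded in number: they raise a bounded
potential by at least one, and no other move changes it. -/
lemma exists_play_potential (V : Type*) [NormedAddCommGroup V] [InnerProductSpace ℝ V]
    (d : ℕ → ℝ) (hd : ∀ i, 0 < d i) (R : ℝ) (j : ℕ) :
    ∃ C : ℝ, ∀ (J : ℕ → ℕ) (p : ℕ → V) (b : ℕ → ℕ → V), IsPlay d J p b → Monotone J →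
      (∀ n, ‖p n‖ ≤ R) → ∃ f : ℕ → ℝ, (∀ n, 0 ≤ f n ∧ f n ≤ C) ∧
        ∀ n, j ≤ J n → f n ≤ f (n + 1) ∧
          (exitIndex d (J n) (b n) (p (n + 1)) ≤ j → f n + 1 ≤ f (n + 1)) := by
  obtain ⟨Φ, C, h1, h2, h3⟩ := exists_potential V d hd R j
  refine ⟨C, fun J p b h hJ hR => ⟨fun n => Φ (b n), fun n => h1 _ (h.norm_base_le hR n),
    fun n hn => ?_⟩⟩
  have key : exitIndex d (J n) (b n) (p (n + 1)) ≤ j → Φ (b n) + 1 ≤ Φ (b (n + 1)) := by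
    intro hl
    rw [h.next, update]
    refine h3 _ _ _ (h.norm_base_le hR n) (hR _) hl ?_
    have h4 := h.gain hJ n (hl.trans hn)
    have h5 := (exitIndex_spec d (J n) (b n) (p (n + 1))).resolve_left (not_lt.2 (hl.trans hn))
    have h6 := pow_le_pow_left₀ (hd _).le h5 2
    linarith
  refine ⟨?_, key⟩
  rcases le_or_gt (exitIndex d (J n) (b n) (p (n + 1))) j with hl | hl
  · linarith [key hl]
  · refine (h2 _ _ fun i hi => ?_).le
    rw [h.next, update, resetFrom, if_pos (hi.trans_lt hl)]

/-- A bounded sequence that is eventually nondecreasing jumps by one only finitely often. -/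
lemma eventually_not_jump {f : ℕ → ℝ} {C : ℝ} (hf : ∀ n, f n ≤ C) {N : ℕ}
    (hmono : ∀ n ≥ N, f n ≤ f (n + 1)) {P : ℕ → Prop}
    (hP : ∀ n ≥ N, P n → f n + 1 ≤ f (n + 1)) : ∃ M ≥ N, ∀ n ≥ M, ¬ P n := by
  have hm : Monotone fun k => f (N + k) :=
    monotone_nat_of_le_succ fun k => hmono _ (Nat.le_add_right _ _)
  have hlim := tendsto_atTop_ciSup hm ⟨C, by rintro _ ⟨k, rfl⟩; exact hf _⟩
  have h1 := (hlim.comp (Filter.tendsto_add_atTop_nat 1)).sub hlim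
  rw [sub_self] at h1
  obtain ⟨K, hK⟩ := (h1.eventually_lt_const (zero_lt_one)).exists_forall_of_atTop
  refine ⟨N + K, Nat.le_add_right _ _, fun n hn hPn => ?_⟩
  obtain ⟨k, rfl⟩ := Nat.exists_eq_add_of_le (le_of_add_le_left hn)
  have h2 := hK k (by omega)
  have h3 := hP _ (Nat.le_add_right _ _) hPn
  simp only [Function.comp] at h2
  rw [← add_assoc] at h2
  linarith

/-- Once `J` has reached `j`, only finitely many resets touch index `j`. Then `b n j` is frozen, and
all later positions stay within `d j` of it. -/
lemma IsPlay.cauchySeq {d : ℕ → ℝ} {J : ℕ → ℕ} {p : ℕ → V} {b : ℕ → ℕ → V}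
    (h : IsPlay d J p b) (hd : ∀ i, 0 < d i) (hd0 : Filter.Tendsto d Filter.atTop (nhds 0))
    (hJ : Monotone J) (hJ' : Filter.Tendsto J Filter.atTop Filter.atTop)
    {R : ℝ} (hR : ∀ n, ‖p n‖ ≤ R) : CauchySeq p := by
  rw [Metric.cauchySeq_iff']
  intro ε hε
  obtain ⟨j, hj⟩ := (hd0.eventually_lt_const (half_pos hε)).exists
  obtain ⟨C, hC⟩ := exists_play_potential V d hd R j
  obtain ⟨f, hf, hf'⟩ := hC J p b h hJ hR
  obtain ⟨N, hN⟩ := (hJ'.eventually_ge_atTop j).exists_forall_of_atTop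
  obtain ⟨M, hMN, hM⟩ := eventually_not_jump (fun n => (hf n).2) (N := N)
    (fun n hn => (hf' n (hN n hn)).1) (fun n hn => (hf' n (hN n hn)).2)
  have hconst : ∀ n ≥ M, b n j = b M j := by
    intro n hn
    induction n, hn using Nat.le_induction with
    | base => rfl
    | succ n hn ih =>
      rw [h.next, update, resetFrom, if_pos (not_le.1 (hM n hn)), ih]
  refine ⟨M, fun n hn => ?_⟩
  have h1 := h.norm_sub_base_lt hd n j
  have h2 := h.norm_sub_base_lt hd M j
  rw [hconst n hn] at h1
  rw [← dist_eq_norm] at h1 h2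
  rw [dist_comm] at h2
  linarith [dist_triangle (p n) (b M j) (p M)]

/-- In a long block of moves at a constant level, some move is short. -/
lemma exists_short_step (V : Type*) [NormedAddCommGroup V] [InnerProductSpace ℝ V]
    (d : ℕ → ℝ) (hd : ∀ i, 0 < d i) :
    ∃ L : ℕ → ℕ, ∀ (J : ℕ → ℕ) (p : ℕ → V) (b : ℕ → ℕ → V), IsPlay d J p b → Monotone J →
      ∀ j a : ℕ, (∀ n, ‖p n‖ ≤ j) → (∀ n, a ≤ n → n < a + L j → J n = j) →
        ∃ n, a ≤ n ∧ n < a + L j ∧ ‖p (n + 1) - p n‖ < 2 * d j := by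
  choose C hC using fun j : ℕ => exists_play_potential V d hd j j
  -- The block has more moves than the potential can count. A move of length at least `2 * d j`
  -- starts within `d j` of the base point `b j`, hence ends at distance at least `d j` from it and
  -- causes a reset at an index `≤ j`.
  refine ⟨fun j => ⌊C j⌋₊ + 1, fun J p b h hJ j a hR hblock => ?_⟩
  obtain ⟨f, hf, hf'⟩ := hC j J p b h hJ hR
  by_contra! hcon
  have hjump : ∀ k ≤ ⌊C j⌋₊ + 1, (k : ℝ) ≤ f (a + k) := by
    intro k hk
    induction k with
    | zero => simpa using (hf a).1
    | succ k ih =>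
      have hlt : a + k < a + (⌊C j⌋₊ + 1) := by omega
      have hJn := hblock (a + k) (by omega) hlt
      have hlong := hcon (a + k) (by omega) hlt
      have hb := h.norm_sub_base_lt hd (a + k) j
      have h1 : d j ≤ ‖p (a + k + 1) - b (a + k) j‖ := by
        have := norm_sub_le (p (a + k + 1) - b (a + k) j) (p (a + k) - b (a + k) j)
        rw [sub_sub_sub_cancel_right] at this
        linarith
      have h2 := (hf' (a + k) hJn.ge).2 (Nat.sInf_le (Or.inr h1))
      have := ih (by omega)
      push_cast
      rw [← add_assoc]
      linarith
  have h1 := hjump _ le_rfl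
  have h2 := (hf (a + (⌊C j⌋₊ + 1))).2
  have h3 := Nat.lt_floor_add_one (C j)
  push_cast at h1
  linarith

/-- A nondecreasing unbounded sequence with prescribed minimal block lengths. -/
lemma exists_block_levels (L : ℕ → ℕ) :
    ∃ J : ℕ → ℕ, Monotone J ∧ Filter.Tendsto J Filter.atTop Filter.atTop ∧
      ∀ j, ∃ a ≥ j, ∀ n, a ≤ n → n < a + L j → J n = j := by
  -- Block `j` starts at `S j`; the extra `1` makes `S` strictly increasing even where `L` vanishes,
  -- whence `j ≤ S j`.
  set S : ℕ → ℕ := fun j => ∑ i ∈ Finset.range j, (L i + 1) with hS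
  have hSs : ∀ j, S (j + 1) = S j + (L j + 1) := fun j => Finset.sum_range_succ _ _
  have hSm : StrictMono S := strictMono_nat_of_lt_succ fun j => by rw [hSs]; omega
  have hfind : ∀ n, S (Nat.findGreatest (fun j => S j ≤ n) n) ≤ n := fun n =>
    Nat.findGreatest_spec (P := fun j => S j ≤ n) (m := 0) (Nat.zero_le n) (by simp [hS])
  have hge : ∀ {n j}, S j ≤ n → j ≤ Nat.findGreatest (fun j => S j ≤ n) n := fun {n j} h =>
    Nat.le_findGreatest (hSm.le_apply.trans h) h
  refine ⟨fun n => Nat.findGreatest (fun j => S j ≤ n) n, fun m n hmn => ?_, ?_, fun j => ?_⟩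
  · exact hge ((hfind m).trans hmn)
  · exact Filter.tendsto_atTop_atTop.2 fun j => ⟨S j, fun n hn => hge hn⟩
  · refine ⟨S j, hSm.le_apply, fun n h1 h2 => le_antisymm ?_ (hge h1)⟩
    by_contra! h3
    have h4 := (hSm.monotone (Nat.succ_le_of_lt h3)).trans (hfind n)
    simp only [Nat.succ_eq_add_one, hSs] at h4
    omega

end Game

/-! ### A smooth triangular wave -/

section Sawtooth

/-- A smooth approximation (as `k` increases to `1`) of a triangular wave of slope `1`. -/
noncomputable def smoothTriangle (k t : ℝ) : ℝ := Real.arcsin (k * Real.sin t) + Real.pi / 2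

/-- The derivative of `smoothTriangle k`. -/
noncomputable def smoothTriangleDeriv (k t : ℝ) : ℝ :=
  k * Real.cos t / √(1 - (k * Real.sin t) ^ 2)

lemma smoothTriangle_nonneg (k t : ℝ) : 0 ≤ smoothTriangle k t := by
  linarith [Real.neg_pi_div_two_le_arcsin (k * Real.sin t), smoothTriangle.eq_1 k t]

lemma smoothTriangle_le (k t : ℝ) : smoothTriangle k t ≤ Real.pi := by
  linarith [Real.arcsin_le_pi_div_two (k * Real.sin t), smoothTriangle.eq_1 k t]

lemma abs_mul_sin_lt_one {k : ℝ} (h0 : 0 < k) (h1 : k < 1) (t : ℝ) :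
    |k * Real.sin t| < 1 := by
  rw [abs_mul, abs_of_pos h0]
  nlinarith [Real.abs_sin_le_one t, abs_nonneg (Real.sin t)]

lemma one_sub_sq_pos {k : ℝ} (h0 : 0 < k) (h1 : k < 1) (t : ℝ) :
    0 < 1 - (k * Real.sin t) ^ 2 := by
  have := (sq_lt_one_iff_abs_lt_one _).2 (abs_mul_sin_lt_one h0 h1 t)
  linarith

lemma hasDerivAt_smoothTriangle {k : ℝ} (h0 : 0 < k) (h1 : k < 1) (t : ℝ) :
    HasDerivAt (smoothTriangle k) (smoothTriangleDeriv k t) t := by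
  have h := abs_lt.1 (abs_mul_sin_lt_one h0 h1 t)
  have := ((Real.hasDerivAt_arcsin h.1.ne' h.2.ne).comp t
    ((Real.hasDerivAt_sin t).const_mul k)).add_const (Real.pi / 2)
  refine this.congr_deriv ?_
  rw [smoothTriangleDeriv]
  ring

lemma contDiff_smoothTriangle {k : ℝ} (h0 : 0 < k) (h1 : k < 1) :
    ContDiff ℝ 1 (smoothTriangle k) := by
  refine ContDiff.add (contDiff_iff_contDiffAt.2 fun t => ?_) contDiff_const
  have h := abs_lt.1 (abs_mul_sin_lt_one h0 h1 t)
  exact ContDiffAt.comp (g := Real.arcsin) (f := fun t => k * Real.sin t) t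
    (Real.contDiffAt_arcsin h.1.ne' h.2.ne) (contDiff_const.mul Real.contDiff_sin).contDiffAt

lemma continuous_smoothTriangleDeriv {k : ℝ} (h0 : 0 < k) (h1 : k < 1) :
    Continuous (smoothTriangleDeriv k) := by
  refine Continuous.div (by fun_prop) (by fun_prop) fun t => ?_
  exact (Real.sqrt_pos.2 (one_sub_sq_pos h0 h1 t)).ne'

lemma abs_smoothTriangleDeriv_le_one {k : ℝ} (h0 : 0 < k) (h1 : k < 1) (t : ℝ) :
    |smoothTriangleDeriv k t| ≤ 1 := by
  have h := Real.sqrt_pos.2 (one_sub_sq_pos h0 h1 t)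
  rw [smoothTriangleDeriv, abs_div, abs_of_pos h, div_le_one h]
  refine Real.abs_le_sqrt ?_
  have h2 : (k * Real.cos t) ^ 2 + (k * Real.sin t) ^ 2 = k ^ 2 := by
    rw [mul_pow, mul_pow, ← mul_add, Real.cos_sq_add_sin_sq, mul_one]
  nlinarith

/-- Squaring `|derivative| < 1/2` gives `3 k² cos² t < 1 - k²`. Thus, for `k` near 1, the slope is
below `1/2` only near the zeros of the cosine. -/
lemma cos_sq_lt_of_abs_smoothTriangleDeriv_lt {k κ t : ℝ} (h0 : 0 < k) (h1 : k < 1)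
    (hκ : 1 - k ^ 2 ≤ 3 * κ * k ^ 2) (h : |smoothTriangleDeriv k t| < 1 / 2) :
    Real.cos t ^ 2 < κ := by
  have hp := one_sub_sq_pos h0 h1 t
  have hs := Real.sqrt_pos.2 hp
  rw [smoothTriangleDeriv, abs_div, abs_of_pos hs, div_lt_iff₀ hs] at h
  have h2 := pow_lt_pow_left₀ h (abs_nonneg _) two_ne_zero
  rw [sq_abs, mul_pow, mul_pow, Real.sq_sqrt hp.le] at h2
  have h3 : k ^ 2 * Real.cos t ^ 2 < k ^ 2 * κ := by
    nlinarith [Real.sin_sq_add_cos_sq t]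
  exact lt_of_mul_lt_mul_left h3 (sq_nonneg _)

end Sawtooth

/-! ### Sawtooth bumps and ball coverings up to small measure -/

section Measure

/-- Rounding of the values of a measurable function that is locally constant almost everywhere
along the function. -/
lemma exists_rounding {α : Type*} [MeasurableSpace α] (μ : Measure α) [SFinite μ]
    {s : α → ℝ} (hs : Measurable s) {η : ℝ} (hη : 0 < η) :
    ∃ R : ℝ → ℝ, (∀ t, |R t - t| ≤ η) ∧
      ∀ᵐ x ∂μ, ∀ᶠ t in nhds (s x), R t = R (s x) := by
  have hc : Set.Countable {t | 0 < μ {x | s x = t}} :=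
    Measure.countable_meas_level_set_pos hs
  have hc' : Set.Countable (⋃ k : ℤ, (fun t => t - k * η) '' {t | 0 < μ {x | s x = t}}) :=
    countable_iUnion fun k => hc.image _
  -- The function is rounded down to the grid `c + ηℤ`. The offset `c` avoids a countable set, so
  -- that no grid value is taken on a set of positive measure.
  obtain ⟨c, hcn⟩ : ∃ c : ℝ, c ∉ ⋃ k : ℤ, (fun t => t - k * η) '' {t | 0 < μ {x | s x = t}} := by
    by_contra! h
    exact Cardinal.not_countable_real (hc'.mono fun x _ => h x)
  have hnull : ∀ k : ℤ, μ {x | s x = c + k * η} = 0 := by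
    intro k
    by_contra h
    exact hcn (mem_iUnion.2 ⟨k, c + k * η, pos_iff_ne_zero.2 h, by simp⟩)
  refine ⟨fun t => c + ⌊(t - c) / η⌋ * η, fun t => ?_, ?_⟩
  · have h1 := Int.floor_le ((t - c) / η)
    have h2 := Int.lt_floor_add_one ((t - c) / η)
    rw [le_div_iff₀ hη] at h1
    rw [div_lt_iff₀ hη] at h2
    rw [abs_le]
    constructor <;> linarith
  · have : ∀ᵐ x ∂μ, ∀ k : ℤ, s x ≠ c + k * η := ae_all_iff.2 fun k => by
      rw [ae_iff]; simpa using hnull k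
    filter_upwards [this] with x hx
    set k := ⌊(s x - c) / η⌋ with hk
    have h1 := Int.floor_le ((s x - c) / η)
    have h2 := Int.lt_floor_add_one ((s x - c) / η)
    rw [← hk, le_div_iff₀ hη] at h1
    rw [← hk, div_lt_iff₀ hη] at h2
    have h3 : c + k * η < s x := lt_of_le_of_ne (by linarith) (hx k).symm
    have h4 : s x < c + (k + 1) * η := by linarith
    filter_upwards [Ioo_mem_nhds h3 h4] with t ht
    have h5 : ⌊(t - c) / η⌋ = k := by
      rw [Int.floor_eq_iff, le_div_iff₀ hη, div_lt_iff₀ hη]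
      exact ⟨by linarith [ht.1], by linarith [ht.2]⟩
    rw [h5]

variable {X : Type*} [NormedAddCommGroup X] [NormedSpace ℝ X] [FiniteDimensional ℝ X]
  [MeasurableSpace X] [BorelSpace X] (μ : Measure X) [μ.IsAddHaarMeasure]

lemma measure_level_set_linear_eq_zero {e : X →L[ℝ] ℝ} (he : e ≠ 0) (a : ℝ) :
    μ {x | e x = a} = 0 := by
  rcases eq_empty_or_nonempty {x | e x = a} with h | ⟨x₀, hx₀⟩
  · simp [h]
  · have h1 : {x | e x = a} = (fun x => x + -x₀) ⁻¹' (e.ker : Set X) := by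
      ext x
      simp only [mem_ofPred_eq, mem_preimage, SetLike.mem_coe, LinearMap.mem_ker] at hx₀ ⊢
      simp [hx₀, ← sub_eq_add_neg, sub_eq_zero]
    rw [h1, measure_preimage_add_right]
    refine Measure.addHaar_submodule μ _ fun h => he ?_
    ext x
    have : x ∈ e.ker := h ▸ Submodule.mem_top
    simpa using this

lemma measure_cos_linear_eq_zero {e : X →L[ℝ] ℝ} (he : e ≠ 0) :
    μ {x | Real.cos (e x) = 0} = 0 := by
  refine measure_mono_null (t := ⋃ k : ℤ, {x | e x = (2 * k + 1) * Real.pi / 2})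
    (fun x hx => ?_) (measure_iUnion_null fun k => measure_level_set_linear_eq_zero μ he _)
  obtain ⟨k, hk⟩ := Real.cos_eq_zero_iff.1 hx
  exact mem_iUnion.2 ⟨k, hk⟩

/-- A closed ball is filled by smaller concentric balls up to a small measure. -/
lemma exists_lt_measure_closedBall_diff_le (c : X) {ρ : ℝ} (hρ : 0 < ρ) {θ : ENNReal}
    (hθ : θ ≠ 0) :
    ∃ ρ', 0 < ρ' ∧ ρ' < ρ ∧ μ (Metric.closedBall c ρ \ Metric.closedBall c ρ') ≤ θ := by
  obtain ⟨a, ha_mono, ha_lt, ha_lim⟩ := exists_seq_strictMono_tendsto' hρ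
  have h1 : Filter.Tendsto
      (fun n => μ (Metric.closedBall c ρ \ Metric.closedBall c (a n))) Filter.atTop
      (nhds (μ (⋂ n, Metric.closedBall c ρ \ Metric.closedBall c (a n)))) := by
    refine tendsto_measure_iInter_atTop (fun n => ?_) (fun m n hmn => ?_) ⟨0, ?_⟩
    · exact (measurableSet_closedBall.diff measurableSet_closedBall).nullMeasurableSet
    · exact sdiff_subset_sdiff_right (Metric.closedBall_subset_closedBall (ha_mono.monotone hmn))
    · exact ((measure_mono sdiff_subset).trans_lt measure_closedBall_lt_top).ne
  have h2 : μ (⋂ n, Metric.closedBall c ρ \ Metric.closedBall c (a n)) = 0 := by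
    refine measure_mono_null (fun x hx => ?_) (Measure.addHaar_sphere_of_ne_zero μ c hρ.ne')
    rw [mem_iInter] at hx
    refine le_antisymm (hx 0).1 (le_of_tendsto' ha_lim fun n => ?_)
    exact (not_le.1 (hx n).2).le
  rw [h2] at h1
  obtain ⟨n, hn⟩ := (h1.eventually_le_const (pos_iff_ne_zero.2 hθ)).exists
  exact ⟨a n, (ha_lt n).1, (ha_lt n).2, hn⟩

/-- A bump function in a ball, of arbitrarily small size, whose derivative runs through a segment
in the direction `e` up to a small error, and is mostly close to the end points. -/
lemma exists_bump_sawtooth (c : X) {ρ : ℝ} (hρ : 0 < ρ) {e : X →L[ℝ] ℝ} (he : e ≠ 0)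
    {r η : ℝ} (hr : 0 < r) (hη : 0 < η) {θ : ENNReal} (hθ : θ ≠ 0) :
    ∃ v s s' : X → ℝ, ContDiff ℝ 1 v ∧ (∀ x, 0 ≤ v x) ∧ (∀ x, v x ≤ η) ∧
      (∀ x ∉ Metric.closedBall c ρ, v x = 0) ∧ (∀ x, |s x| ≤ r) ∧
      (∀ x, ‖fderiv ℝ v x - s x • e‖ ≤ η) ∧ (∀ x, ‖fderiv ℝ v x - s' x • e‖ ≤ η) ∧
      (∀ᵐ x ∂μ, ∀ᶠ y in nhds x, s' y = s' x) ∧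
      μ {x ∈ Metric.closedBall c ρ | |s' x| < r / 4} ≤ θ := by
  have hθ2 : θ / 2 ≠ 0 := (ENNReal.half_pos hθ).ne'
  obtain ⟨ρ', hρ'0, hρ'ρ, hρ'μ⟩ := exists_lt_measure_closedBall_diff_le μ c hρ hθ2
  let f : ContDiffBump c := ⟨ρ', ρ, hρ'0, hρ'ρ⟩
  have hf1 : ContDiff ℝ 1 f := f.contDiff
  obtain ⟨C, hC⟩ := (hf1.continuous_fderiv one_ne_zero).bounded_above_of_compact_support
    (f.hasCompactSupport.fderiv (𝕜 := ℝ))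
  have hC0 : 0 ≤ C := (norm_nonneg _).trans (hC c)
  have hpi := Real.pi_pos
  -- The wavelength parameter `w` is so small that both the height `r w π` of the wave and the error
  -- `r w π C` from differentiating the cutoff are at most `η / 2`.
  set w : ℝ := η / 2 / (r * Real.pi * (1 + C)) with hw
  have hw0 : 0 < w := by positivity
  have hwη : r * w * Real.pi * (1 + C) = η / 2 := by rw [hw]; field_simp
  have hwA : r * w * Real.pi ≤ η / 2 := by
    have : 0 ≤ r * w * Real.pi * C := by positivity
    linarith
  have hwB : r * w * Real.pi * C ≤ η / 2 := by
    have : 0 ≤ r * w * Real.pi := by positivity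
    linarith
  set e' : X →L[ℝ] ℝ := w⁻¹ • e with he'
  have he'0 : e' ≠ 0 := smul_ne_zero (inv_ne_zero hw0.ne') he
  -- the flatness parameter
  obtain ⟨κ, hκ0, hκ⟩ : ∃ κ > (0 : ℝ),
      μ {x ∈ Metric.closedBall c ρ | Real.cos (e' x) ^ 2 < κ} ≤ θ / 2 := by
    have h1 : Filter.Tendsto
        (fun n : ℕ => μ {x ∈ Metric.closedBall c ρ | Real.cos (e' x) ^ 2 < 1 / ((n : ℝ) + 1)})
        Filter.atTop
        (nhds (μ (⋂ n : ℕ, {x ∈ Metric.closedBall c ρ |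
          Real.cos (e' x) ^ 2 < 1 / ((n : ℝ) + 1)}))) := by
      refine tendsto_measure_iInter_atTop (fun n => ?_) (fun m n hmn x hx => ⟨hx.1, ?_⟩) ⟨0, ?_⟩
      · refine (measurableSet_closedBall.inter (IsOpen.measurableSet ?_)).nullMeasurableSet
        exact isOpen_lt ((Real.continuous_cos.comp e'.continuous).pow 2) continuous_const
      · exact hx.2.trans_le (one_div_le_one_div_of_le (by positivity) (by gcongr))
      · exact ((measure_mono (sep_subset _ _)).trans_lt measure_closedBall_lt_top).ne
    have h2 : μ (⋂ n : ℕ, {x ∈ Metric.closedBall c ρ |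
        Real.cos (e' x) ^ 2 < 1 / ((n : ℝ) + 1)}) = 0 := by
      refine measure_mono_null (fun x hx => ?_) (measure_cos_linear_eq_zero μ he'0)
      rw [mem_iInter] at hx
      have : Real.cos (e' x) ^ 2 ≤ 0 :=
        ge_of_tendsto' tendsto_one_div_add_atTop_nhds_zero_nat fun n => (hx n).2.le
      exact pow_eq_zero_iff two_ne_zero |>.1 (le_antisymm this (sq_nonneg _))
    rw [h2] at h1
    obtain ⟨n, hn⟩ := (h1.eventually_le_const (pos_iff_ne_zero.2 hθ2)).exists
    exact ⟨_, by positivity, hn⟩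
  obtain ⟨k, hk0, hk1, hk⟩ : ∃ k : ℝ, 0 < k ∧ k < 1 ∧ 1 - k ^ 2 ≤ 3 * κ * k ^ 2 := by
    -- This `k` satisfies `1 - k² = 3 κ k²`.
    refine ⟨√(1 / (1 + 3 * κ)), by positivity, ?_, ?_⟩
    · rw [Real.sqrt_lt' one_pos, one_pow, div_lt_one (by positivity)]
      linarith
    · rw [Real.sq_sqrt (by positivity)]
      apply le_of_eq
      field_simp
      ring
  set g : X → ℝ := fun x => smoothTriangle k (e' x) with hg
  have hg1 : ContDiff ℝ 1 g := (contDiff_smoothTriangle hk0 hk1).comp e'.contDiff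
  set s : X → ℝ := fun x => f x * (r * smoothTriangleDeriv k (e' x)) with hs
  have hs_cont : Continuous s := f.continuous.mul
    (continuous_const.mul ((continuous_smoothTriangleDeriv hk0 hk1).comp e'.continuous))
  -- A rounding error of at most `r / 4` keeps slopes of size at least `r / 2` above `r / 4`; the
  -- second bound keeps the error in the covector at most `η / 2`.
  set ε₁ : ℝ := min (r / 4) (η / 2 / (1 + ‖e‖)) with hε₁
  have hε₁0 : 0 < ε₁ := by positivity
  obtain ⟨R, hR, hR'⟩ := exists_rounding μ hs_cont.measurable hε₁0
  have hderiv : ∀ x, ‖fderiv ℝ (fun x => f x * (r * w * g x)) x - s x • e‖ ≤ η / 2 := by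
    intro x
    have h1 : HasFDerivAt g (smoothTriangleDeriv k (e' x) • e') x :=
      (hasDerivAt_smoothTriangle hk0 hk1 (e' x)).comp_hasFDerivAt x e'.hasFDerivAt
    have h2 : HasFDerivAt (fun x => f x * (r * w * g x))
        (f x • ((r * w) • (smoothTriangleDeriv k (e' x) • e'))
          + (r * w * g x) • fderiv ℝ f x) x :=
      ((hf1.differentiable one_ne_zero x).hasFDerivAt).mul (h1.const_mul (r * w))
    have h3 : (f x • ((r * w) • (smoothTriangleDeriv k (e' x) • e'))
        + (r * w * g x) • fderiv ℝ f x) - s x • e = (r * w * g x) • fderiv ℝ f x := by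
      have : f x • ((r * w) • (smoothTriangleDeriv k (e' x) • e')) = s x • e := by
        simp only [hs]
        generalize smoothTriangleDeriv k (e' x) = D
        rw [he', smul_smul, smul_smul, smul_smul]
        congr 1
        field_simp
      rw [this, add_sub_cancel_left]
    rw [h2.fderiv, h3, norm_smul, Real.norm_eq_abs,
      abs_of_nonneg (by have := smoothTriangle_nonneg k (e' x); positivity)]
    calc r * w * g x * ‖fderiv ℝ f x‖ ≤ r * w * Real.pi * C := by
          gcongr
          · exact smoothTriangle_le _ _
          · exact hC x
      _ ≤ η / 2 := hwB
  refine ⟨fun x => f x * (r * w * g x), s, fun x => R (s x), hf1.mul (contDiff_const.mul hg1),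
    fun x => ?_, fun x => ?_, fun x hx => ?_, fun x => ?_, fun x => ?_, fun x => ?_, ?_, ?_⟩
  · have := smoothTriangle_nonneg k (e' x)
    exact mul_nonneg f.nonneg (by positivity)
  · have h0 := smoothTriangle_nonneg k (e' x)
    calc f x * (r * w * g x) ≤ 1 * (r * w * Real.pi) := by
          gcongr
          · exact f.le_one
          · exact smoothTriangle_le _ _
      _ ≤ η := by linarith
  · have : f x = 0 := f.zero_of_le_dist (not_le.1 hx).le
    simp [this]
  · simp only [hs, abs_mul, abs_of_pos hr, abs_of_nonneg f.nonneg]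
    calc f x * (r * |smoothTriangleDeriv k (e' x)|) ≤ 1 * (r * 1) := by
          gcongr
          · exact f.le_one
          · exact abs_smoothTriangleDeriv_le_one hk0 hk1 _
      _ = r := by ring
  · linarith [hderiv x]
  · have h1 : ‖(s x - R (s x)) • e‖ ≤ η / 2 := by
      rw [norm_smul, Real.norm_eq_abs, abs_sub_comm]
      calc |R (s x) - s x| * ‖e‖ ≤ η / 2 / (1 + ‖e‖) * (1 + ‖e‖) := by
            gcongr
            · exact (hR _).trans (min_le_right _ _)
            · linarith
        _ = η / 2 := by field_simp
    have h2 := norm_add_le (fderiv ℝ (fun x => f x * (r * w * g x)) x - s x • e)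
      ((s x - R (s x)) • e)
    rw [show (s x - R (s x)) • e = s x • e - R (s x) • e by ext; simp [sub_mul]] at h1 h2
    rw [sub_add_sub_cancel] at h2
    linarith [hderiv x]
  · filter_upwards [hR'] with x hx
    exact hs_cont.continuousAt.eventually hx
  · have hsub : {x ∈ Metric.closedBall c ρ | |R (s x)| < r / 4} ⊆
        (Metric.closedBall c ρ \ Metric.closedBall c ρ') ∪
          {x ∈ Metric.closedBall c ρ | Real.cos (e' x) ^ 2 < κ} := by
      rintro x ⟨hx, hlt⟩
      by_cases hx' : x ∈ Metric.closedBall c ρ'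
      · right
        refine ⟨hx, cos_sq_lt_of_abs_smoothTriangleDeriv_lt hk0 hk1 hk ?_⟩
        have h1 : f x = 1 := f.one_of_mem_closedBall hx'
        have h2 : |s x| = r * |smoothTriangleDeriv k (e' x)| := by
          simp [hs, h1, abs_mul, abs_of_pos hr]
        have h3 := (hR (s x)).trans (min_le_left _ _)
        have h4 := abs_sub_abs_le_abs_sub (s x) (R (s x))
        rw [abs_sub_comm (s x)] at h4
        have h5 : r * |smoothTriangleDeriv k (e' x)| < r * (1 / 2) := by linarith
        exact lt_of_mul_lt_mul_left h5 hr.le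
      · exact Or.inl ⟨hx, hx'⟩
    calc μ {x ∈ Metric.closedBall c ρ | |R (s x)| < r / 4} ≤ θ / 2 + θ / 2 :=
          (measure_mono hsub).trans ((measure_union_le _ _).trans (add_le_add hρ'μ hκ))
      _ = θ := ENNReal.add_halves θ

/-- An open set of finite measure is filled by finitely many disjoint closed balls with prescribed
radius bounds, up to a small measure. -/
lemma exists_finset_closedBall_measure_diff_le {U : Set X} (hU : IsOpen U) (hUμ : μ U ≠ ⊤)
    (R : X → ℝ) (hR : ∀ x ∈ U, 0 < R x) {θ : ENNReal} (hθ : θ ≠ 0) :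
    ∃ (t : Finset X) (ρ : X → ℝ), (∀ c ∈ t, c ∈ U ∧ 0 < ρ c ∧ ρ c ≤ R c) ∧
      (t : Set X).PairwiseDisjoint (fun c => Metric.closedBall c (ρ c)) ∧
      μ (U \ ⋃ c ∈ t, Metric.closedBall c (ρ c)) ≤ θ := by
  obtain ⟨t, ρ, ht, htU, hρ, hnull, hdisj⟩ := Besicovitch.exists_disjoint_closedBall_covering_ae μ
    (fun _ => univ) U (fun x _ δ hδ => ⟨δ / 2, mem_univ _, by positivity, by linarith⟩) R hR
  have : Countable t := ht.to_subtype
  have h1 : Filter.Tendsto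
      (fun T : Finset t => μ (U \ ⋃ c ∈ T, Metric.closedBall (c : X) (ρ c))) Filter.atTop
      (nhds (μ (⋂ T : Finset t, U \ ⋃ c ∈ T, Metric.closedBall (c : X) (ρ c)))) := by
    refine tendsto_measure_iInter_atTop (fun T => ?_) (fun S T hST => ?_) ⟨∅, ?_⟩
    · exact (hU.measurableSet.diff
        (T.measurableSet_biUnion fun c _ => measurableSet_closedBall)).nullMeasurableSet
    · exact sdiff_subset_sdiff_right (biUnion_subset_biUnion_left hST)
    · exact ((measure_mono sdiff_subset).trans_lt hUμ.lt_top).ne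
  have h2 : μ (⋂ T : Finset t, U \ ⋃ c ∈ T, Metric.closedBall (c : X) (ρ c)) = 0 := by
    refine measure_mono_null (fun x hx => ?_) hnull
    rw [mem_iInter] at hx
    refine ⟨(hx ∅).1, fun hx' => ?_⟩
    obtain ⟨c, hc, hxc⟩ := mem_iUnion₂.1 hx'
    exact (hx {⟨c, hc⟩}).2 (by simpa using hxc)
  rw [h2] at h1
  obtain ⟨T, hT⟩ := (h1.eventually_le_const (pos_iff_ne_zero.2 hθ)).exists
  refine ⟨T.map (Function.Embedding.subtype _), ρ, fun c hc => ?_, hdisj.subset ?_, ?_⟩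
  · obtain ⟨⟨c, hc'⟩, -, rfl⟩ := Finset.mem_map.1 hc
    exact ⟨htU hc', (hρ c hc').2.1, (hρ c hc').2.2.le⟩
  · intro c hc
    obtain ⟨⟨c, hc'⟩, -, rfl⟩ := Finset.mem_map.1 hc
    exact hc'
  · refine le_trans (measure_mono (sdiff_subset_sdiff_right fun x hx => ?_)) hT
    obtain ⟨c, hc, hxc⟩ := mem_iUnion₂.1 hx
    exact mem_iUnion₂.2 ⟨c, Finset.mem_map_of_mem _ hc, hxc⟩

end Measure

/-! ### One perturbation inside the region where `F` is negative -/

section Perturbation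

variable {X : Type*} [NormedAddCommGroup X] [NormedSpace ℝ X]

/-- If `F < 0` along a compact segment of covectors over `x`, then `F < 0` on a uniform
neighbourhood of the corresponding segments over the points near `x`. -/
lemma exists_radius_forall_neg {Ω : Set X} (hΩ : IsOpen Ω) {F : ℝ → X → (X →L[ℝ] ℝ) → ℝ}
    (hF : ContinuousOn (fun q : ℝ × X × (X →L[ℝ] ℝ) => F q.1 q.2.1 q.2.2) (univ ×ˢ Ω ×ˢ univ))
    {u : X → ℝ} (hu : ContDiff ℝ 1 u) {x : X} (hx : x ∈ Ω) {e : X →L[ℝ] ℝ} {r : ℝ}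
    (hneg : ∀ s ∈ Icc (-r) r, F (u x) x (fderiv ℝ u x + s • e) < 0) :
    ∃ κ > (0 : ℝ), ∀ᶠ y in nhds x, y ∈ Ω ∧ ∀ a ∈ Icc (0 : ℝ) κ, ∀ s ∈ Icc (-r) r,
      ∀ q : X →L[ℝ] ℝ, ‖q - s • e‖ ≤ κ → F (u y + a) y (fderiv ℝ u y + q) < 0 := by
  set W : Set (ℝ × X × (X →L[ℝ] ℝ)) := (univ ×ˢ Ω ×ˢ univ) ∩
    (fun q : ℝ × X × (X →L[ℝ] ℝ) => F q.1 q.2.1 q.2.2) ⁻¹' Iio 0 with hW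
  have hWo : IsOpen W :=
    hF.isOpen_inter_preimage (isOpen_univ.prod (hΩ.prod isOpen_univ)) isOpen_Iio
  set S : Set (ℝ × X × (X →L[ℝ] ℝ)) :=
    (fun s : ℝ => (u x, x, fderiv ℝ u x + s • e)) '' Icc (-r) r with hS
  have hSc : IsCompact S := isCompact_Icc.image (by fun_prop)
  have hSW : S ⊆ W := by
    rintro _ ⟨s, hs, rfl⟩
    exact ⟨⟨mem_univ _, hx, mem_univ _⟩, hneg s hs⟩
  obtain ⟨δ, hδ, hδW⟩ := hSc.exists_thickening_subset_open hWo hSW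
  have hu0 : Continuous u := hu.continuous
  have hu1 : Continuous (fderiv ℝ u) := hu.continuous_fderiv one_ne_zero
  refine ⟨δ / 4, by positivity, ?_⟩
  filter_upwards [hΩ.mem_nhds hx, Metric.ball_mem_nhds x hδ,
    hu0.continuousAt (Metric.ball_mem_nhds (u x) (show 0 < δ / 4 by positivity)),
    hu1.continuousAt (Metric.ball_mem_nhds (fderiv ℝ u x) (show 0 < δ / 4 by positivity))]
    with y hyΩ hyx hyu hyd
  refine ⟨hyΩ, fun a ha s hs q hq => ?_⟩
  have hmem : (u y + a, y, fderiv ℝ u y + q) ∈ Metric.thickening δ S := by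
    refine Metric.mem_thickening_iff.2 ⟨_, ⟨s, hs, rfl⟩, ?_⟩
    rw [Prod.dist_eq, Prod.dist_eq, max_lt_iff, max_lt_iff]
    refine ⟨?_, hyx, ?_⟩
    · have h1 : |u y - u x| < δ / 4 := hyu
      have h2 : |a| ≤ δ / 4 := by rw [abs_of_nonneg ha.1]; exact ha.2
      rw [Real.dist_eq, add_sub_right_comm]
      linarith [abs_add_le (u y - u x) a]
    · have h1 : ‖fderiv ℝ u y - fderiv ℝ u x‖ < δ / 4 := by
        rw [← dist_eq_norm]; exact hyd
      simp only
      rw [dist_eq_norm, add_sub_add_comm]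
      linarith [norm_add_le (fderiv ℝ u y - fderiv ℝ u x) (q - s • e)]
  exact (hδW hmem).2

variable [FiniteDimensional ℝ X] [MeasurableSpace X] [BorelSpace X] (μ : Measure X)
  [μ.IsAddHaarMeasure]

/-- One step of the construction: a small compactly supported perturbation whose derivative is
close to the direction field `e`, and which has a long step at most of the points where the whole
segment of direction `e` and length `2 * r` remains in `{F < 0}`. -/
lemma exists_perturbation {Ω : Set X} (hΩ : IsOpen Ω) {F : ℝ → X → (X →L[ℝ] ℝ) → ℝ}
    (hF : ContinuousOn (fun q : ℝ × X × (X →L[ℝ] ℝ) => F q.1 q.2.1 q.2.2) (univ ×ˢ Ω ×ˢ univ))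
    {u : X → ℝ} (hu : ContDiff ℝ 1 u) (e : X → X →L[ℝ] ℝ) (he : ∀ x, e x ≠ 0)
    {ψ : X → ℝ} (hψ : ContinuousOn ψ Ω) (hψ0 : ∀ x ∈ Ω, 0 < ψ x)
    {r η : ℝ} (hr : 0 < r) (hη : 0 < η) (ρ : ℝ) {θ : ENNReal} (hθ : θ ≠ 0) :
    ∃ v s : X → ℝ, ContDiff ℝ 1 v ∧ HasCompactSupport v ∧ (∀ x ∉ Ω, v x = 0) ∧
      (∀ x, 0 ≤ v x) ∧ (∀ x ∈ Ω, v x ≤ ψ x) ∧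
      (∀ x, ‖fderiv ℝ v x - s x • e x‖ ≤ η) ∧ (∀ x, ‖fderiv ℝ v x‖ ≤ r * ‖e x‖ + η) ∧
      (∀ x ∈ Ω, F (u x) x (fderiv ℝ u x) ≤ 0 →
        F (u x + v x) x (fderiv ℝ u x + fderiv ℝ v x) ≤ 0) ∧
      (∀ᵐ x ∂μ, ∀ᶠ y in nhds x, s y = s x) ∧
      μ {x ∈ Ω ∩ Metric.ball 0 ρ | (∀ᶠ y in nhds x, e y = e x) ∧
        (∀ t ∈ Icc (-r) r, F (u x) x (fderiv ℝ u x + t • e x) < 0) ∧ |s x| < r / 4} ≤ θ := by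
  set U : Set X := {x | x ∈ Ω ∩ Metric.ball 0 ρ ∧ (∀ᶠ y in nhds x, e y = e x) ∧
    ∀ t ∈ Icc (-r) r, F (u x) x (fderiv ℝ u x + t • e x) < 0} with hU
  -- local data
  have hloc : ∀ x ∈ U, ∃ κ > (0 : ℝ), ∀ᶠ y in nhds x, y ∈ Ω ∧ e y = e x ∧ κ ≤ ψ y ∧
      ∀ a ∈ Icc (0 : ℝ) κ, ∀ s ∈ Icc (-r) r, ∀ q : X →L[ℝ] ℝ, ‖q - s • e x‖ ≤ κ →
        F (u y + a) y (fderiv ℝ u y + q) < 0 := by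
    rintro x ⟨⟨hxΩ, -⟩, hxe, hxF⟩
    obtain ⟨κ, hκ, h⟩ := exists_radius_forall_neg hΩ hF hu hxΩ hxF
    have h1 := hψ0 x hxΩ
    have h2 : ∀ᶠ y in nhds x, ψ x / 2 < ψ y :=
      (hψ.continuousAt (hΩ.mem_nhds hxΩ)).eventually_const_lt (by linarith)
    refine ⟨min κ (ψ x / 2), by positivity, ?_⟩
    filter_upwards [h, h2, hxe] with y hy hy2 hye
    exact ⟨hy.1, hye, (min_le_right _ _).trans hy2.le, fun a ha s hs q hq =>
      hy.2 a ⟨ha.1, ha.2.trans (min_le_left _ _)⟩ s hs q (hq.trans (min_le_left _ _))⟩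
  have hUo : IsOpen U := by
    refine isOpen_iff_mem_nhds.2 fun x hx => ?_
    obtain ⟨κ, hκ, h⟩ := hloc x hx
    filter_upwards [h, Metric.isOpen_ball.mem_nhds hx.1.2, hx.2.1.eventually_nhds]
      with y hy hyρ hye
    refine ⟨⟨hy.1, hyρ⟩, ?_, fun t ht => ?_⟩
    · filter_upwards [hye] with z hz
      rw [hz, hy.2.1]
    · have := hy.2.2.2 0 ⟨le_rfl, hκ.le⟩ t ht (t • e x) (by simpa using hκ.le)
      rwa [add_zero, ← hy.2.1] at this
  have hUμ : μ U ≠ ⊤ := ((measure_mono fun x hx => hx.1.2).trans_lt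
    (measure_ball_lt_top (x := (0 : X)) (r := ρ))).ne
  have hloc' : ∀ x, ∃ κ > (0 : ℝ), ∃ R > (0 : ℝ), x ∈ U → ∀ y ∈ Metric.closedBall x R,
      y ∈ Ω ∧ e y = e x ∧ κ ≤ ψ y ∧
      ∀ a ∈ Icc (0 : ℝ) κ, ∀ s ∈ Icc (-r) r, ∀ q : X →L[ℝ] ℝ, ‖q - s • e x‖ ≤ κ →
        F (u y + a) y (fderiv ℝ u y + q) < 0 := by
    intro x
    by_cases hx : x ∈ U
    · obtain ⟨κ, hκ, h⟩ := hloc x hx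
      obtain ⟨R, hR, hR'⟩ := Metric.nhds_basis_closedBall.mem_iff.1 h
      exact ⟨κ, hκ, R, hR, fun _ y hy => hR' hy⟩
    · exact ⟨1, one_pos, 1, one_pos, fun h => absurd h hx⟩
  choose κ hκ R hR hloc' using hloc'
  have hθ2 : θ / 2 ≠ 0 := (ENNReal.half_pos hθ).ne'
  obtain ⟨t, rad, ht, hdisj, hcover⟩ :=
    exists_finset_closedBall_measure_diff_le μ hUo hUμ R (fun x _ => hR x) hθ2
  set θ' : ENNReal := θ / 2 / (t.card + 1) with hθ'
  have hθ'0 : θ' ≠ 0 := ENNReal.div_ne_zero.2 ⟨hθ2, by finiteness⟩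
  have hball : ∀ c, ∃ v s s' : X → ℝ, c ∈ t → ContDiff ℝ 1 v ∧ (∀ x, 0 ≤ v x) ∧
      (∀ x, v x ≤ min η (κ c)) ∧
      (∀ x ∉ Metric.closedBall c (rad c), v x = 0) ∧ (∀ x, |s x| ≤ r) ∧
      (∀ x, ‖fderiv ℝ v x - s x • e c‖ ≤ min η (κ c)) ∧
      (∀ x, ‖fderiv ℝ v x - s' x • e c‖ ≤ min η (κ c)) ∧
      (∀ᵐ x ∂μ, ∀ᶠ y in nhds x, s' y = s' x) ∧
      μ {x ∈ Metric.closedBall c (rad c) | |s' x| < r / 4} ≤ θ' := by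
    intro c
    by_cases hc : c ∈ t
    · obtain ⟨v, s, s', h⟩ := exists_bump_sawtooth μ c (ht c hc).2.1 (he c) hr
        (lt_min hη (hκ c)) hθ'0
      exact ⟨v, s, s', fun _ => h⟩
    · exact ⟨0, 0, 0, fun h => absurd h hc⟩
  choose v s s' hball using hball
  have hin : ∀ c ∈ t, ∀ x ∈ Metric.closedBall c (rad c), x ∈ Ω ∧ e x = e c ∧ κ c ≤ ψ x ∧
      ∀ a ∈ Icc (0 : ℝ) (κ c), ∀ s ∈ Icc (-r) r, ∀ q : X →L[ℝ] ℝ, ‖q - s • e c‖ ≤ κ c →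
        F (u x + a) x (fderiv ℝ u x + q) < 0 := fun c hc x hx =>
    hloc' c (ht c hc).1 x (Metric.closedBall_subset_closedBall (ht c hc).2.2 hx)
  have hv0 : ∀ c ∈ t, ∀ x ∉ Metric.closedBall c (rad c), v c =ᶠ[nhds x] 0 := by
    intro c hc x hx
    filter_upwards [Metric.isClosed_closedBall.isOpen_compl.mem_nhds hx] with y hy
    exact (hball c hc).2.2.2.1 y hy
  have hother : ∀ c ∈ t, ∀ x ∈ Metric.closedBall c (rad c), ∀ c' ∈ t, c' ≠ c →
      x ∉ Metric.closedBall c' (rad c') := fun c hc x hx c' hc' hne hx' =>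
    (disjoint_left.1 (hdisj hc' hc hne) hx') hx
  set w : X → ℝ := fun x => ∑ c ∈ t, v c x with hw
  -- The rounded slopes need not vanish outside their balls, hence the indicators. These can spoil
  -- local constancy only on the bounding spheres, which are null.
  set σ : X → ℝ := fun x => ∑ c ∈ t, (Metric.closedBall c (rad c)).indicator (s' c) x with hσ
  have hw_in : ∀ c ∈ t, ∀ x ∈ Metric.closedBall c (rad c), w =ᶠ[nhds x] v c := by
    intro c hc x hx
    have h1 : ∀ᶠ y in nhds x, ∀ c' ∈ t, c' ≠ c → v c' y = 0 := by
      refine (Filter.eventually_all_finset t).2 fun c' hc' => ?_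
      by_cases hne : c' = c
      · simp [hne]
      · filter_upwards [hv0 c' hc' x (hother c hc x hx c' hc' hne)] with y hy _
        exact hy
    filter_upwards [h1] with y hy
    exact Finset.sum_eq_single_of_mem c hc fun c' hc' hne => hy c' hc' hne
  have hσ_in : ∀ c ∈ t, ∀ x ∈ Metric.closedBall c (rad c), σ x = s' c x := by
    intro c hc x hx
    rw [hσ]
    simp only
    rw [Finset.sum_eq_single_of_mem c hc fun c' hc' hne =>
      indicator_of_notMem (hother c hc x hx c' hc' hne) _, indicator_of_mem hx]
  have hw_out : ∀ x, (∀ c ∈ t, x ∉ Metric.closedBall c (rad c)) → w =ᶠ[nhds x] 0 := by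
    intro x hx
    filter_upwards [(Filter.eventually_all_finset t).2 fun c hc => hv0 c hc x (hx c hc)] with y hy
    exact Finset.sum_eq_zero fun c hc => hy c hc
  have hσ_out : ∀ x, (∀ c ∈ t, x ∉ Metric.closedBall c (rad c)) → σ x = 0 := fun x hx =>
    Finset.sum_eq_zero fun c hc => indicator_of_notMem (hx c hc) _
  have hcases : ∀ x, (∃ c ∈ t, x ∈ Metric.closedBall c (rad c)) ∨
      ∀ c ∈ t, x ∉ Metric.closedBall c (rad c) := fun x => by
    by_cases h : ∃ c ∈ t, x ∈ Metric.closedBall c (rad c)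
    · exact Or.inl h
    · push Not at h
      exact Or.inr h
  refine ⟨w, σ, ContDiff.sum fun c hc => (hball c hc).1, ?_, fun x hx => ?_, fun x => ?_,
    fun x hx => ?_, fun x => ?_, fun x => ?_, fun x hx hFx => ?_, ?_, ?_⟩
  · refine HasCompactSupport.intro
      (t.isCompact_biUnion fun c _ => isCompact_closedBall c (rad c)) fun x hx => ?_
    simp only [mem_iUnion, not_exists] at hx
    exact (hw_out x hx).eq_of_nhds
  · rcases hcases x with ⟨c, hc, hxc⟩ | h
    · exact absurd (hin c hc x hxc).1 hx
    · exact (hw_out x h).eq_of_nhds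
  · exact Finset.sum_nonneg fun c hc => (hball c hc).2.1 x
  · rcases hcases x with ⟨c, hc, hxc⟩ | h
    · rw [(hw_in c hc x hxc).eq_of_nhds]
      exact ((hball c hc).2.2.1 x).trans ((min_le_right _ _).trans (hin c hc x hxc).2.2.1)
    · rw [(hw_out x h).eq_of_nhds]
      exact (hψ0 x hx).le
  · rcases hcases x with ⟨c, hc, hxc⟩ | h
    · rw [(hw_in c hc x hxc).fderiv_eq, hσ_in c hc x hxc, (hin c hc x hxc).2.1]
      exact ((hball c hc).2.2.2.2.2.2.1 x).trans (min_le_left _ _)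
    · rw [(hw_out x h).fderiv_eq, hσ_out x h]
      simpa using hη.le
  · rcases hcases x with ⟨c, hc, hxc⟩ | h
    · rw [(hw_in c hc x hxc).fderiv_eq, (hin c hc x hxc).2.1]
      have h1 := ((hball c hc).2.2.2.2.2.1 x).trans (min_le_left _ _)
      have h2 : ‖s c x • e c‖ ≤ r * ‖e c‖ := by
        rw [norm_smul]
        exact mul_le_mul_of_nonneg_right ((hball c hc).2.2.2.2.1 x) (norm_nonneg _)
      have h3 := norm_add_le (s c x • e c) (fderiv ℝ (v c) x - s c x • e c)
      rw [add_sub_cancel] at h3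
      linarith
    · rw [(hw_out x h).fderiv_eq]
      simp only [fderiv_zero, Pi.zero_apply, norm_zero]
      positivity
  · rcases hcases x with ⟨c, hc, hxc⟩ | h
    · rw [(hw_in c hc x hxc).fderiv_eq, (hw_in c hc x hxc).eq_of_nhds]
      have hb := hball c hc
      exact ((hin c hc x hxc).2.2.2 _ ⟨hb.2.1 x, (hb.2.2.1 x).trans (min_le_right _ _)⟩ (s c x)
        (abs_le.1 (hb.2.2.2.2.1 x)) _ ((hb.2.2.2.2.2.1 x).trans (min_le_right _ _))).le
    · rw [(hw_out x h).fderiv_eq, (hw_out x h).eq_of_nhds]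
      simpa using hFx
  · have h1 : ∀ᵐ x ∂μ, ∀ c ∈ t, ∀ᶠ y in nhds x, s' c y = s' c x :=
      (Finset.eventually_all t).2 fun c hc => (hball c hc).2.2.2.2.2.2.2.1
    have h2 : ∀ᵐ x ∂μ, ∀ c ∈ t, x ∉ Metric.sphere c (rad c) :=
      (Finset.eventually_all t).2 fun c hc =>
        measure_eq_zero_iff_ae_notMem.1
          (Measure.addHaar_sphere_of_ne_zero μ c (ht c hc).2.1.ne')
    filter_upwards [h1, h2] with x hx1 hx2
    rcases hcases x with ⟨c, hc, hxc⟩ | h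
    · have hxb : x ∈ Metric.ball c (rad c) := lt_of_le_of_ne hxc (hx2 c hc)
      filter_upwards [hx1 c hc, Metric.isOpen_ball.mem_nhds hxb] with y hy hyb
      rw [hσ_in c hc x hxc, hσ_in c hc y (Metric.ball_subset_closedBall hyb), hy]
    · have : ∀ᶠ y in nhds x, ∀ c ∈ t, y ∉ Metric.closedBall c (rad c) :=
        (Filter.eventually_all_finset t).2 fun c hc =>
          Metric.isClosed_closedBall.isOpen_compl.mem_nhds (h c hc)
      filter_upwards [this] with y hy
      rw [hσ_out x h, hσ_out y hy]
  · have hsub : {x ∈ Ω ∩ Metric.ball 0 ρ | (∀ᶠ y in nhds x, e y = e x) ∧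
        (∀ t ∈ Icc (-r) r, F (u x) x (fderiv ℝ u x + t • e x) < 0) ∧ |σ x| < r / 4} ⊆
        (U \ ⋃ c ∈ t, Metric.closedBall c (rad c)) ∪
          ⋃ c ∈ t, {x ∈ Metric.closedBall c (rad c) | |s' c x| < r / 4} := by
      rintro x ⟨h1, h2, h3, h4⟩
      rcases hcases x with ⟨c, hc, hxc⟩ | h
      · rw [hσ_in c hc x hxc] at h4
        exact Or.inr (mem_iUnion₂.2 ⟨c, hc, hxc, h4⟩)
      · exact Or.inl ⟨⟨h1, h2, h3⟩, by simpa using h⟩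
    refine (measure_mono hsub).trans ((measure_union_le _ _).trans ?_)
    have hsum : μ (⋃ c ∈ t, {x ∈ Metric.closedBall c (rad c) | |s' c x| < r / 4}) ≤ θ / 2 := by
      refine (measure_biUnion_finset_le _ _).trans ?_
      refine (Finset.sum_le_sum fun c hc => (hball c hc).2.2.2.2.2.2.2.2).trans ?_
      rw [Finset.sum_const, nsmul_eq_mul]
      calc (t.card : ENNReal) * θ' ≤ (t.card + 1) * θ' := by gcongr; exact le_self_add
        _ ≤ θ / 2 := ENNReal.mul_div_le
    calc _ ≤ θ / 2 + θ / 2 := add_le_add hcover hsum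
      _ = θ := ENNReal.add_halves θ

end Perturbation

/-! ### Differentiability of the limit and the size function -/

section Differentiability

variable {X : Type*} [NormedAddCommGroup X] [NormedSpace ℝ X]

/-- A compactly supported `C¹` function is uniformly differentiable. -/
lemma exists_uniform_linear_approx {u : X → ℝ} (hu : ContDiff ℝ 1 u) (hc : HasCompactSupport u)
    {ε : ℝ} (hε : 0 < ε) :
    ∃ δ > (0 : ℝ), ∀ x h, ‖h‖ ≤ δ → |u (x + h) - u x - fderiv ℝ u x h| ≤ ε * ‖h‖ := by
  have huc : UniformContinuous (fderiv ℝ u) :=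
    (hc.fderiv (𝕜 := ℝ)).uniformContinuous_of_continuous (hu.continuous_fderiv one_ne_zero)
  obtain ⟨δ, hδ, h⟩ := Metric.uniformContinuous_iff.1 huc ε hε
  refine ⟨δ / 2, by positivity, fun x k hk => ?_⟩
  have h1 := (convex_closedBall x (δ / 2)).norm_image_sub_le_of_norm_fderiv_le' (𝕜 := ℝ)
    (f := u) (φ := fderiv ℝ u x) (C := ε) (x := x) (y := x + k)
    (fun y _ => hu.differentiable one_ne_zero y)
    (fun y hy => by
      rw [← dist_eq_norm]
      exact (h (lt_of_le_of_lt (Metric.mem_closedBall.1 hy) (by linarith))).le)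
    (Metric.mem_closedBall_self (by positivity)) (by simpa [dist_eq_norm] using hk)
  simpa using h1

/-- The limit of a sequence of functions with decreasing scales of linear approximation `δ n` is
differentiable where the derivatives converge, provided that each increment is small relative to
the previous scales and the increments of the derivatives tend to zero uniformly. -/
lemma hasFDerivAt_of_scales {u : ℕ → X → ℝ} {U : X → ℝ} {δ ω : ℕ → ℝ} {x : X}
    {L : X →L[ℝ] ℝ} (hδ : ∀ n, 0 < δ n) (hδ2 : ∀ n, δ (n + 1) ≤ δ n / 2)
    (hu : ∀ n, Differentiable ℝ (u n))
    (hlin : ∀ n h, ‖h‖ ≤ δ n → |u n (x + h) - u n x - fderiv ℝ (u n) x h| ≤ (1 / 2) ^ n * ‖h‖)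
    (hstep : ∀ n y, |u (n + 1) y - u n y| ≤ (1 / 2) ^ n * δ n)
    (hlip : ∀ n y, ‖fderiv ℝ (u (n + 1)) y - fderiv ℝ (u n) y‖ ≤ ω n)
    (hω : Filter.Tendsto ω Filter.atTop (nhds 0))
    (hU : ∀ y, Filter.Tendsto (fun n => u n y) Filter.atTop (nhds (U y)))
    (hL : Filter.Tendsto (fun n => fderiv ℝ (u n) x) Filter.atTop (nhds L)) :
    HasFDerivAt U L x := by
  have hanti : Antitone δ := antitone_nat_of_succ_le fun n => by linarith [hδ2 n, hδ n]
  have hδ0 : Filter.Tendsto δ Filter.atTop (nhds 0) := by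
    have h1 : ∀ n, δ n ≤ δ 0 * (1 / 2) ^ n := by
      intro n
      induction n with
      | zero => simp
      | succ n ih => rw [pow_succ]; linarith [hδ2 n]
    have h2 : Filter.Tendsto (fun n : ℕ => δ 0 * (1 / 2 : ℝ) ^ n) Filter.atTop (nhds 0) := by
      simpa using (tendsto_pow_atTop_nhds_zero_of_lt_one (by norm_num : (0 : ℝ) ≤ 1 / 2)
        (by norm_num)).const_mul (δ 0)
    exact squeeze_zero (fun n => (hδ n).le) h1 h2
  have htail : ∀ n y, |U y - u n y| ≤ 2 * ((1 / 2) ^ n * δ n) := by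
    intro n y
    have h1 : ∀ k, dist (u (n + k) y) (u (n + (k + 1)) y)
        ≤ 2 * ((1 / 2) ^ n * δ n) / 2 / 2 ^ k := by
      intro k
      rw [dist_comm, Real.dist_eq, ← add_assoc]
      refine (hstep (n + k) y).trans ?_
      calc (1 / 2 : ℝ) ^ (n + k) * δ (n + k) ≤ (1 / 2) ^ (n + k) * δ n := by
            gcongr
            exact hanti (Nat.le_add_right _ _)
        _ = 2 * ((1 / 2) ^ n * δ n) / 2 / 2 ^ k := by
            rw [pow_add, one_div_pow (2 : ℝ) k]; ring
    have h2 := dist_le_of_le_geometric_two_of_tendsto₀ h1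
      ((hU y).comp ((Filter.tendsto_add_atTop_nat n).congr fun k => add_comm k n))
    rwa [dist_comm, Real.dist_eq] at h2
  have hincr : ∀ n h, |(u (n + 1) (x + h) - u n (x + h)) - (u (n + 1) x - u n x)|
      ≤ ω n * ‖h‖ := by
    intro n h
    have h1 := (convex_univ (𝕜 := ℝ) (E := X)).norm_image_sub_le_of_norm_fderiv_le (𝕜 := ℝ)
      (f := u (n + 1) - u n) (C := ω n) (x := x) (y := x + h)
      (fun y _ => (hu (n + 1) y).sub (hu n y))
      (fun y _ => by
        rw [fderiv_sub (hu (n + 1) y) (hu n y)]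
        exact hlip n y) (mem_univ _) (mem_univ _)
    simpa using h1
  -- The factor 3 collects one linearization error at stage `n` and two tails of the series from
  -- stage `n + 1` on, each contributing `(1 / 2) ^ n`.
  have hcoef : Filter.Tendsto
      (fun n => 3 * (1 / 2 : ℝ) ^ n + ‖fderiv ℝ (u n) x - L‖ + ω n) Filter.atTop (nhds 0) := by
    have h1 : Filter.Tendsto (fun n : ℕ => 3 * (1 / 2 : ℝ) ^ n) Filter.atTop (nhds 0) := by
      simpa using (tendsto_pow_atTop_nhds_zero_of_lt_one (by norm_num : (0 : ℝ) ≤ 1 / 2)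
        (by norm_num)).const_mul 3
    simpa using (h1.add (tendsto_iff_norm_sub_tendsto_zero.1 hL)).add hω
  rw [hasFDerivAt_iff_isLittleO_nhds_zero, Asymptotics.isLittleO_iff]
  intro c hc
  obtain ⟨N, hN⟩ := (hcoef.eventually_le_const hc).exists_forall_of_atTop
  filter_upwards [Metric.closedBall_mem_nhds (0 : X) (hδ N)] with h hh
  rw [mem_closedBall_zero_iff] at hh
  rcases eq_or_ne h 0 with rfl | hne
  · simp
  have hpos : 0 < ‖h‖ := norm_pos_iff.2 hne
  -- The stage `n` is chosen with `δ (n + 1) < ‖h‖ ≤ δ n`: stage `n` is nearly linear at this scale,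
  -- the tail after stage `n + 1` is negligible against `‖h‖`, and the single increment in between
  -- is Lipschitz with small constant `ω n`.
  have hex : ∃ m, δ m < ‖h‖ := (hδ0.eventually_lt_const hpos).exists
  classical
  obtain ⟨n, hn⟩ : ∃ n, Nat.find hex = n + 1 := by
    refine Nat.exists_eq_succ_of_ne_zero fun h0 => ?_
    have := Nat.find_spec hex
    rw [h0] at this
    linarith [hanti (Nat.zero_le N)]
  have hn1 : δ (n + 1) < ‖h‖ := hn ▸ Nat.find_spec hex
  have hn2 : ‖h‖ ≤ δ n := not_lt.1 (Nat.find_min hex (hn ▸ Nat.lt_succ_self n))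
  have hNn : N ≤ n := by
    by_contra! hlt
    linarith [hanti (Nat.succ_le_of_lt hlt)]
  have e1 := hlin n h hn2
  have e2 := hincr n h
  have e3 := htail (n + 1) (x + h)
  have e4 := htail (n + 1) x
  have e5 : |(fderiv ℝ (u n) x - L) h| ≤ ‖fderiv ℝ (u n) x - L‖ * ‖h‖ :=
    (fderiv ℝ (u n) x - L).le_opNorm h
  have e6 : (1 / 2 : ℝ) ^ (n + 1) * δ (n + 1) ≤ (1 / 2) ^ (n + 1) * ‖h‖ := by gcongr
  rw [pow_succ (1 / 2 : ℝ) n] at e6 e3 e4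
  have e7 := mul_le_mul_of_nonneg_right (hN n hNn) hpos.le
  rw [sub_apply] at e5
  rw [Real.norm_eq_abs]
  refine le_trans ?_ e7
  rw [abs_le] at e1 e2 e3 e4 e5 ⊢
  constructor <;> nlinarith

lemma hasFDerivAt_zero_of_abs_le_dist_sq {f : X → ℝ} {x : X}
    (hf : ∀ y, |f y - f x| ≤ dist y x ^ 2) : HasFDerivAt f (0 : X →L[ℝ] ℝ) x := by
  rw [hasFDerivAt_iff_isLittleO_nhds_zero]
  refine Asymptotics.IsBigO.trans_isLittleO (g := fun h : X => ‖h‖ ^ 2) ?_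
    (Asymptotics.isLittleO_norm_pow_id one_lt_two)
  refine Asymptotics.IsBigO.of_bound 1 (Filter.Eventually.of_forall fun h => ?_)
  simpa [dist_eq_norm] using hf (x + h)

/-- A positive continuous function on `Ω` that is small enough for the coercivity of `F` and for
the differentiability at the boundary. -/
lemma exists_size_function [FiniteDimensional ℝ X] {Ω : Set X} (hΩ : IsOpen Ω)
    {F : ℝ → X → (X →L[ℝ] ℝ) → ℝ}
    (hB : ∀ K : Set X, IsCompact K → K ⊆ Ω →
      ∃ α > (0 : ℝ), ∃ M > (0 : ℝ), ∀ x ∈ K, ∀ r ∈ Icc (0 : ℝ) α,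
        ∀ p : X →L[ℝ] ℝ, M ≤ ‖p‖ → 0 < F r x p)
    {ε : ℝ} (hε : 0 < ε) :
    ∃ φ : X → ℝ, ContinuousOn φ Ω ∧ ∀ x ∈ Ω, 0 < φ x ∧ φ x ≤ ε ∧
      (∀ z ∉ Ω, φ x ≤ dist x z ^ 2) ∧
      ∃ M : ℝ, ∀ r ∈ Icc 0 (φ x), ∀ p : X →L[ℝ] ℝ, M ≤ ‖p‖ → 0 < F r x p := by
  have : ProperSpace X := FiniteDimensional.proper ℝ X
  set t : Ω → Set ℝ := fun x => {a | 0 < a ∧ a ≤ ε ∧ (∀ z ∉ Ω, a ≤ dist (x : X) z ^ 2) ∧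
    ∃ M : ℝ, ∀ r ∈ Icc 0 a, ∀ p : X →L[ℝ] ℝ, M ≤ ‖p‖ → 0 < F r x p} with ht
  have hconv : ∀ x, Convex ℝ (t x) := by
    intro x
    refine OrdConnected.convex ⟨fun a ha b hb c hc => ⟨ha.1.trans_le hc.1, hc.2.trans hb.2.1,
      fun z hz => hc.2.trans (hb.2.2.1 z hz), ?_⟩⟩
    obtain ⟨M, hM⟩ := hb.2.2.2
    exact ⟨M, fun r hr => hM r ⟨hr.1, hr.2.trans hc.2⟩⟩
  -- The admissible values at each point form an interval, so locally valid constants can be glued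
  -- by a partition of unity. Halving `R` keeps nearby points at distance at least `R / 2` from the
  -- complement of `Ω`.
  obtain ⟨g, hg⟩ := exists_continuous_forall_mem_convex_of_local_const hconv fun x => by
    obtain ⟨R, hR, hRΩ⟩ := Metric.nhds_basis_closedBall.mem_iff.1 (hΩ.mem_nhds x.2)
    obtain ⟨α, hα, M, -, hM⟩ := hB _ (isCompact_closedBall (x : X) R) hRΩ
    refine ⟨min (min ε ((R / 2) ^ 2)) α, ?_⟩
    have hnear : ∀ᶠ y : Ω in nhds x, dist (y : X) x < R / 2 :=
      continuous_subtype_val.continuousAt (Metric.ball_mem_nhds (x : X) (half_pos hR))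
    filter_upwards [hnear] with y hy
    refine ⟨by positivity, (min_le_left _ _).trans (min_le_left _ _), fun z hz => ?_,
      M, fun r hr => hM y (Metric.mem_closedBall.2 (by linarith)) r
        ⟨hr.1, hr.2.trans (min_le_right _ _)⟩⟩
    refine (min_le_left _ _).trans ((min_le_right _ _).trans ?_)
    have hzR : R < dist z x := not_le.1 fun h => hz (hRΩ h)
    have := dist_triangle_left z (x : X) (y : X)
    gcongr
    linarith
  classical
  refine ⟨fun x => if h : x ∈ Ω then g ⟨x, h⟩ else 0, ?_, fun x hx => ?_⟩
  · rw [continuousOn_iff_continuous_domRestrict]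
    convert g.continuous using 1
    ext x
    simp [x.2]
  · simp only [dif_pos hx]
    exact hg ⟨x, hx⟩

end Differentiability

/-! ### Stages of the construction -/

section Main

variable {X V : Type*} [NormedAddCommGroup X] [NormedSpace ℝ X]
  [NormedAddCommGroup V] [InnerProductSpace ℝ V]

lemma exists_unit_inner_eq_zero [FiniteDimensional ℝ V] (hV : 2 ≤ Module.finrank ℝ V) (w : V) :
    ∃ e : V, ‖e‖ = 1 ∧ inner ℝ e w = 0 := by
  have h1 := Submodule.finrank_add_finrank_orthogonal (Submodule.span ℝ {w})
  have h2 : Module.finrank ℝ (Submodule.span ℝ {w}) ≤ 1 := by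
    simpa using finrank_span_le_card (R := ℝ) ({w} : Set V)
  obtain ⟨e, he, he0⟩ := Submodule.exists_mem_ne_zero_of_ne_bot
    (p := (Submodule.span ℝ {w})ᗮ) (fun h => by rw [h, finrank_bot] at h1; omega)
  refine ⟨‖e‖⁻¹ • e, norm_smul_inv_norm he0, ?_⟩
  rw [real_inner_smul_left, real_inner_comm,
    Submodule.mem_orthogonal_singleton_iff_inner_right.1 he, mul_zero]

/-- The data of one stage of the construction: the approximate solution `u`, its scale `δ` of
linear approximation, the position `p` and the base points `b` of the game played at each point. -/
structure Stage (X V : Type*) where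
  u : X → ℝ
  δ : ℝ
  p : X → V
  b : X → ℕ → V

/-- The direction in which the gradient of a stage is to be moved. -/
noncomputable def Stage.direction (T : V →L[ℝ] X →L[ℝ] ℝ) (dir : V → V) (j : ℕ) (S : Stage X V) (x : X) :
    X →L[ℝ] ℝ :=
  T (dir (S.p x - gameCenter (S.b x) (j + 1)))

/-- `locConst` makes the next direction field locally constant almost everywhere, which is what
allows a sawtooth in a fixed direction on small balls. -/
structure Stage.IsAdmissible [MeasurableSpace X] (μ : Measure X) (Ω : Set X)
    (F : ℝ → X → (X →L[ℝ] ℝ) → ℝ) (n : ℕ) (S : Stage X V) : Prop where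
  contDiff : ContDiff ℝ 1 S.u
  compact : HasCompactSupport S.u
  eq_zero : ∀ x ∉ Ω, S.u x = 0
  sub : ∀ x ∈ Ω, F (S.u x) x (fderiv ℝ S.u x) ≤ 0
  pos : 0 < S.δ
  linear : ∀ x h, ‖h‖ ≤ S.δ → |S.u (x + h) - S.u x - fderiv ℝ S.u x h| ≤ (1 / 2) ^ n * ‖h‖
  locConst : ∀ᵐ x ∂μ, ∀ᶠ y in nhds x, S.p y = S.p x ∧ S.b y = S.b x

/-- The position moves by the rounded slope `s`, so it follows the gradient only up to the summable
error in `deriv_near`. `le_scale` and `scale` serve differentiability, `le_size` keeps the solution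
below `φ`, and `measure` prepares Borel–Cantelli. -/
structure Stage.IsStep [MeasurableSpace X] (μ : Measure X) (Ω : Set X)
    (F : ℝ → X → (X →L[ℝ] ℝ) → ℝ) (φ : X → ℝ) (T : V →L[ℝ] X →L[ℝ] ℝ) (dir : V → V)
    (d : ℕ → ℝ) (j n : ℕ) (S S' : Stage X V) (s : X → ℝ) : Prop where
  next_p : ∀ x, S'.p x = S.p x + s x • dir (S.p x - gameCenter (S.b x) (j + 1))
  next_b : ∀ x, S'.b x = update d j (S.b x) (S'.p x)
  mono : ∀ x, S.u x ≤ S'.u x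
  le_scale : ∀ x, S'.u x - S.u x ≤ (1 / 2) ^ n * S.δ
  le_size : ∀ x ∈ Ω, S'.u x - S.u x ≤ (1 / 2) ^ (n + 1) * φ x
  deriv_near : ∀ x, ‖fderiv ℝ S'.u x - fderiv ℝ S.u x - T (S'.p x - S.p x)‖ ≤ (1 / 2) ^ n
  deriv_incr : ∀ x, ‖fderiv ℝ S'.u x - fderiv ℝ S.u x‖ ≤ 8 * d j * ‖T‖ + (1 / 2) ^ n
  scale : S'.δ ≤ S.δ / 2
  measure : μ {x ∈ Ω ∩ Metric.ball 0 n | (∀ᶠ y in nhds x, S.p y = S.p x ∧ S.b y = S.b x) ∧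
    (∀ t ∈ Icc (-(8 * d j)) (8 * d j),
      F (S.u x) x (fderiv ℝ S.u x + t • S.direction T dir j x) < 0) ∧ |s x| < 2 * d j}
    ≤ 2⁻¹ ^ n

lemma Stage.exists_step [FiniteDimensional ℝ X] [MeasurableSpace X] [BorelSpace X]
    (μ : Measure X) [μ.IsAddHaarMeasure] {Ω : Set X} (hΩ : IsOpen Ω)
    {F : ℝ → X → (X →L[ℝ] ℝ) → ℝ}
    (hF : ContinuousOn (fun q : ℝ × X × (X →L[ℝ] ℝ) => F q.1 q.2.1 q.2.2) (univ ×ˢ Ω ×ˢ univ))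
    {φ : X → ℝ} (hφ : ContinuousOn φ Ω) (hφ0 : ∀ x ∈ Ω, 0 < φ x)
    {T : V →L[ℝ] X →L[ℝ] ℝ} (hT : Function.Injective T) {dir : V → V}
    (hdir : ∀ w, ‖dir w‖ = 1) {d : ℕ → ℝ} (hd : ∀ i, 0 < d i) (j n : ℕ) (S : Stage X V)
    (hS : S.IsAdmissible μ Ω F n) :
    ∃ S' : Stage X V, S'.IsAdmissible μ Ω F (n + 1) ∧
      ∃ s, S.IsStep μ Ω F φ T dir d j n S' s := by
  have hdj := hd j
  have hδ := hS.pos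
  have he : ∀ x, S.direction T dir j x ≠ 0 := by
    intro x h
    have h1 := hT (h.trans T.map_zero.symm)
    have h2 := hdir (S.p x - gameCenter (S.b x) (j + 1))
    rw [h1, norm_zero] at h2
    exact zero_ne_one h2
  have henorm : ∀ x, ‖S.direction T dir j x‖ ≤ ‖T‖ := by
    intro x
    have := T.le_opNorm (dir (S.p x - gameCenter (S.b x) (j + 1)))
    rwa [hdir, mul_one] at this
  have hψ : ContinuousOn (fun x => min ((1 / 2) ^ (n + 1) * φ x) ((1 / 2) ^ n * S.δ)) Ω :=
    ContinuousOn.inf (continuousOn_const.mul hφ) continuousOn_const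
  -- The amplitude `r = 8 * d j` is chosen so that the guaranteed slope `r / 4` is `2 * d j`, the
  -- threshold of `exists_short_step`.
  obtain ⟨v, s, hv1, hvc, hv0, hvnn, hvψ, hvd, hvl, hvF, hs, hμ⟩ :=
    exists_perturbation μ hΩ hF hS.contDiff (S.direction T dir j) he hψ
      (fun x hx => by have := hφ0 x hx; positivity) (show 0 < 8 * d j by positivity)
      (show (0 : ℝ) < (1 / 2) ^ n by positivity) (n : ℝ)
      (show (2⁻¹ : ENNReal) ^ n ≠ 0 from pow_ne_zero _ (by simp))
  have hu' : ContDiff ℝ 1 (S.u + v) := hS.contDiff.add hv1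
  have hc' : HasCompactSupport (S.u + v) := hS.compact.add hvc
  have hfd : ∀ x, fderiv ℝ (S.u + v) x = fderiv ℝ S.u x + fderiv ℝ v x := fun x =>
    fderiv_add (hS.contDiff.differentiable one_ne_zero x) (hv1.differentiable one_ne_zero x)
  obtain ⟨δ', hδ', hlin⟩ := exists_uniform_linear_approx hu' hc'
    (show (0 : ℝ) < (1 / 2) ^ (n + 1) by positivity)
  set p' : X → V := fun x => S.p x + s x • dir (S.p x - gameCenter (S.b x) (j + 1)) with hp'
  have hTp : ∀ x, T (p' x - S.p x) = s x • S.direction T dir j x := by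
    intro x
    rw [hp', add_sub_cancel_left, map_smul]
    rfl
  refine ⟨⟨S.u + v, min (S.δ / 2) δ', p', fun x => update d j (S.b x) (p' x)⟩,
    ⟨hu', hc', fun x hx => ?_, fun x hx => ?_, by positivity, fun x h hh => ?_, ?_⟩, s,
    ⟨fun x => rfl, fun x => rfl, fun x => ?_, fun x => ?_, fun x hx => ?_, fun x => ?_,
      fun x => ?_, min_le_left _ _, ?_⟩⟩
  · simp [hS.eq_zero x hx, hv0 x hx]
  · rw [hfd]
    exact hvF x hx (hS.sub x hx)
  · exact hlin x h (hh.trans (min_le_right _ _))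
  · filter_upwards [hs, hS.locConst] with x hx1 hx2
    filter_upwards [hx1, hx2] with y hy1 hy2
    have hpy : p' y = p' x := by simp only [hp']; rw [hy1, hy2.1, hy2.2]
    exact ⟨hpy, by simp only [hpy, hy2.2]⟩
  · exact le_add_of_nonneg_right (hvnn x)
  · simp only [Pi.add_apply, add_sub_cancel_left]
    by_cases hx : x ∈ Ω
    · exact (hvψ x hx).trans (min_le_right _ _)
    · rw [hv0 x hx]
      positivity
  · simp only [Pi.add_apply, add_sub_cancel_left]
    exact (hvψ x hx).trans (min_le_left _ _)
  · simp only
    rw [hfd, add_sub_cancel_left, hTp]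
    exact hvd x
  · simp only
    rw [hfd, add_sub_cancel_left]
    refine (hvl x).trans ?_
    gcongr
    exact henorm x
  · refine le_trans (measure_mono fun x hx => ?_) hμ
    refine ⟨hx.1, ?_, hx.2.2.1, ?_⟩
    · filter_upwards [hx.2.1] with y hy
      simp only [Stage.direction, hy.1, hy.2]
    · have := hx.2.2.2
      linarith

end Main

/-! ### Infinite runs and their limits -/

section Limit

variable {X V : Type*} [NormedAddCommGroup X] [NormedSpace ℝ X] [MeasurableSpace X]
  [NormedAddCommGroup V] [InnerProductSpace ℝ V]

/-- An infinite run of the construction. -/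
structure IsRun (μ : Measure X) (Ω : Set X) (F : ℝ → X → (X →L[ℝ] ℝ) → ℝ) (φ : X → ℝ)
    (T : V →L[ℝ] X →L[ℝ] ℝ) (dir : V → V) (d : ℕ → ℝ) (J : ℕ → ℕ) (S : ℕ → Stage X V)
    (s : ℕ → X → ℝ) : Prop where
  init_u : (S 0).u = 0
  init_p : (S 0).p = 0
  init_b : (S 0).b = 0
  admissible : ∀ n, (S n).IsAdmissible μ Ω F n
  step : ∀ n, (S n).IsStep μ Ω F φ T dir d (J n) n (S (n + 1)) (s n)

lemma exists_isRun [FiniteDimensional ℝ X] [BorelSpace X]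
    (μ : Measure X) [μ.IsAddHaarMeasure] {Ω : Set X} (hΩ : IsOpen Ω)
    {F : ℝ → X → (X →L[ℝ] ℝ) → ℝ}
    (hF : ContinuousOn (fun q : ℝ × X × (X →L[ℝ] ℝ) => F q.1 q.2.1 q.2.2) (univ ×ˢ Ω ×ˢ univ))
    (hA : ∀ x ∈ Ω, F 0 x 0 ≤ 0)
    {φ : X → ℝ} (hφ : ContinuousOn φ Ω) (hφ0 : ∀ x ∈ Ω, 0 < φ x)
    {T : V →L[ℝ] X →L[ℝ] ℝ} (hT : Function.Injective T) {dir : V → V}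
    (hdir : ∀ w, ‖dir w‖ = 1) {d : ℕ → ℝ} (hd : ∀ i, 0 < d i) (J : ℕ → ℕ) :
    ∃ (S : ℕ → Stage X V) (s : ℕ → X → ℝ), IsRun μ Ω F φ T dir d J S s := by
  let S₀ : Stage X V := ⟨0, 1, 0, 0⟩
  have hS₀ : S₀.IsAdmissible μ Ω F 0 :=
    ⟨contDiff_const, HasCompactSupport.zero, fun _ _ => rfl,
      fun x hx => by simpa [S₀] using hA x hx, one_pos, fun x h _ => by simp [S₀],
      Filter.Eventually.of_forall fun x => Filter.Eventually.of_forall fun y => ⟨rfl, rfl⟩⟩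
  have : Nonempty (Stage X V) := ⟨S₀⟩
  have hex := fun (n : ℕ) (S : Stage X V) (hS : S.IsAdmissible μ Ω F n) =>
    Stage.exists_step μ hΩ hF hφ hφ0 hT hdir hd (J n) n S hS
  choose! next hnext s hs using hex
  let S : ℕ → Stage X V := fun n => Nat.rec S₀ (fun n S => next n S) n
  have hadm : ∀ n, (S n).IsAdmissible μ Ω F n := by
    intro n
    induction n with
    | zero => exact hS₀
    | succ n ih => exact hnext n _ ih
  exact ⟨S, fun n => s n (S n), rfl, rfl, rfl, hadm, fun n => hs n _ (hadm n)⟩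

namespace IsRun

variable {μ : Measure X} {Ω : Set X} {F : ℝ → X → (X →L[ℝ] ℝ) → ℝ} {φ : X → ℝ}
  {T : V →L[ℝ] X →L[ℝ] ℝ} {dir : V → V} {d : ℕ → ℝ} {J : ℕ → ℕ} {S : ℕ → Stage X V}
  {s : ℕ → X → ℝ}

lemma isPlay (h : IsRun μ Ω F φ T dir d J S s) (hdir : ∀ w, inner ℝ (dir w) w = 0) (x : X) :
    IsPlay d J (fun n => (S n).p x) (fun n => (S n).b x) where
  init := by
    rw [h.init_b, h.init_p]
    rfl
  orth n := by rw [(h.step n).next_p, add_sub_cancel_left, inner_smul_left, hdir, mul_zero]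
  next n := (h.step n).next_b x

lemma u_nonneg (h : IsRun μ Ω F φ T dir d J S s) (n : ℕ) (x : X) : 0 ≤ (S n).u x := by
  induction n with
  | zero => simp [h.init_u]
  | succ n ih => exact ih.trans ((h.step n).mono x)

lemma u_le (h : IsRun μ Ω F φ T dir d J S s) (n : ℕ) {x : X} (hx : x ∈ Ω) :
    (S n).u x ≤ (1 - (1 / 2) ^ n) * φ x := by
  induction n with
  | zero => simp [h.init_u]
  | succ n ih =>
    have h1 := (h.step n).le_size x hx
    rw [pow_succ] at h1 ⊢
    linarith

lemma u_le_size (h : IsRun μ Ω F φ T dir d J S s) (hφ0 : ∀ x ∈ Ω, 0 < φ x) (n : ℕ) {x : X}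
    (hx : x ∈ Ω) : (S n).u x ≤ φ x := by
  refine (h.u_le n hx).trans ?_
  have h1 : (0 : ℝ) ≤ (1 / 2) ^ n := by positivity
  nlinarith [hφ0 x hx]

lemma tendsto_u (h : IsRun μ Ω F φ T dir d J S s) (hφ0 : ∀ x ∈ Ω, 0 < φ x) (x : X) :
    Filter.Tendsto (fun n => (S n).u x) Filter.atTop (nhds (⨆ n, (S n).u x)) := by
  refine tendsto_atTop_ciSup (monotone_nat_of_le_succ fun n => (h.step n).mono x) ?_
  by_cases hx : x ∈ Ω
  · exact ⟨φ x, by rintro _ ⟨n, rfl⟩; exact h.u_le_size hφ0 n hx⟩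
  · exact ⟨0, by rintro _ ⟨n, rfl⟩; exact ((h.admissible n).eq_zero x hx).le⟩

/-- The right-hand side is the partial sum of the errors `(1 / 2) ^ k` in `deriv_near`; a uniform
bound of 2 lets bounds pass between gradients and positions. -/
lemma norm_fderiv_sub_le (h : IsRun μ Ω F φ T dir d J S s) (n : ℕ) (x : X) :
    ‖fderiv ℝ (S n).u x - T ((S n).p x)‖ ≤ 2 - 2 * (1 / 2) ^ n := by
  induction n with
  | zero => simp [h.init_u, h.init_p]
  | succ n ih =>
    have h1 := (h.step n).deriv_near x
    have h2 := norm_add_le (fderiv ℝ (S n).u x - T ((S n).p x))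
      (fderiv ℝ (S (n + 1)).u x - fderiv ℝ (S n).u x - T ((S (n + 1)).p x - (S n).p x))
    have h3 : fderiv ℝ (S (n + 1)).u x - T ((S (n + 1)).p x) =
        (fderiv ℝ (S n).u x - T ((S n).p x)) +
        (fderiv ℝ (S (n + 1)).u x - fderiv ℝ (S n).u x - T ((S (n + 1)).p x - (S n).p x)) := by
      rw [map_sub]
      abel
    rw [h3, pow_succ]
    linarith

/-- Every stage is a subsolution with values in `[0, φ x]`, so coercivity excludes gradients of norm
above `M`; the positions differ from them by at most 2 after applying `T`. -/
lemma exists_norm_p_le (h : IsRun μ Ω F φ T dir d J S s) (hφ0 : ∀ x ∈ Ω, 0 < φ x) {C : NNReal}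
    (hT : AntilipschitzWith C T)
    (hφM : ∀ x ∈ Ω, ∃ M : ℝ, ∀ r ∈ Icc 0 (φ x), ∀ p : X →L[ℝ] ℝ, M ≤ ‖p‖ → 0 < F r x p)
    {x : X} (hx : x ∈ Ω) : ∃ R : ℝ, ∀ n, ‖(S n).p x‖ ≤ R := by
  obtain ⟨M, hM⟩ := hφM x hx
  refine ⟨C * (M + 2), fun n => ?_⟩
  have h1 : ‖fderiv ℝ (S n).u x‖ ≤ M := by
    by_contra! hlt
    exact absurd ((h.admissible n).sub x hx)
      (not_le.2 (hM _ ⟨h.u_nonneg n x, h.u_le_size hφ0 n hx⟩ _ hlt.le))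
  have h2 := h.norm_fderiv_sub_le n x
  have h3 : (0 : ℝ) ≤ (1 / 2) ^ n := by positivity
  have h4 := norm_sub_norm_le (T ((S n).p x)) (fderiv ℝ (S n).u x)
  rw [norm_sub_rev] at h4
  refine (ContinuousLinearMap.bound_of_antilipschitz T hT _).trans ?_
  gcongr
  linarith

/-- The gradient is the image under `T` of a convergent play plus a sequence with geometrically
small increments. -/
lemma exists_tendsto_fderiv [FiniteDimensional ℝ X] (h : IsRun μ Ω F φ T dir d J S s)
    (hdir : ∀ w, inner ℝ (dir w) w = 0) (hd : ∀ i, 0 < d i)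
    (hd0 : Filter.Tendsto d Filter.atTop (nhds 0)) (hJ : Monotone J)
    (hJ' : Filter.Tendsto J Filter.atTop Filter.atTop) {x : X} {R : ℝ}
    (hR : ∀ n, ‖(S n).p x‖ ≤ R) :
    ∃ L, Filter.Tendsto (fun n => fderiv ℝ (S n).u x) Filter.atTop (nhds L) := by
  have h1 : CauchySeq fun n => (S n).p x := (h.isPlay hdir x).cauchySeq hd hd0 hJ hJ' hR
  have h2 : CauchySeq fun n => T ((S n).p x) := T.uniformContinuous.comp_cauchySeq h1
  have h3 : CauchySeq fun n => fderiv ℝ (S n).u x - T ((S n).p x) := by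
    refine cauchySeq_of_le_geometric (1 / 2) 1 (by norm_num) fun n => ?_
    rw [dist_comm, dist_eq_norm, one_mul]
    have h4 := (h.step n).deriv_near x
    rwa [map_sub, sub_sub_sub_comm] at h4
  have h4 := h2.add h3
  simp only [Pi.add_def, add_sub_cancel] at h4
  exact cauchySeq_tendsto_of_complete h4

lemma hasFDerivAt [FiniteDimensional ℝ X] (h : IsRun μ Ω F φ T dir d J S s)
    (hφ0 : ∀ x ∈ Ω, 0 < φ x) (hd0 : Filter.Tendsto d Filter.atTop (nhds 0))
    (hJ' : Filter.Tendsto J Filter.atTop Filter.atTop) {x : X} {L : X →L[ℝ] ℝ}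
    (hL : Filter.Tendsto (fun n => fderiv ℝ (S n).u x) Filter.atTop (nhds L)) :
    HasFDerivAt (fun y => ⨆ n, (S n).u y) L x := by
  refine hasFDerivAt_of_scales (δ := fun n => (S n).δ)
    (ω := fun n => 8 * d (J n) * ‖T‖ + (1 / 2) ^ n) (fun n => (h.admissible n).pos)
    (fun n => (h.step n).scale) (fun n => (h.admissible n).contDiff.differentiable one_ne_zero)
    (fun n => (h.admissible n).linear x) (fun n y => ?_) (fun n => (h.step n).deriv_incr) ?_
    (h.tendsto_u hφ0) hL
  · rw [abs_of_nonneg (sub_nonneg.2 ((h.step n).mono y))]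
    exact (h.step n).le_scale y
  · have h1 := ((hd0.comp hJ').const_mul 8).mul_const ‖T‖
    have h2 := tendsto_pow_atTop_nhds_zero_of_lt_one (by norm_num : (0 : ℝ) ≤ 1 / 2)
      (by norm_num)
    simpa using h1.add h2

/-- Almost every point has a long step at all late stages where a long step is possible. -/
lemma ae_eventually_long_step (h : IsRun μ Ω F φ T dir d J S s) :
    ∀ᵐ x ∂μ, x ∈ Ω → ∀ᶠ n in Filter.atTop,
      (∀ t ∈ Icc (-(8 * d (J n))) (8 * d (J n)),
        F ((S n).u x) x (fderiv ℝ (S n).u x + t • (S n).direction T dir (J n) x) < 0) →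
      2 * d (J n) ≤ |s n x| := by
  have hsum : ∑' n : ℕ, (2⁻¹ : ENNReal) ^ n ≠ ⊤ := by
    rw [ENNReal.tsum_geometric, ENNReal.one_sub_inv_two]
    simp
  -- Borel–Cantelli: the exceptional sets have summable measures. Their restriction to `ball 0 n` is
  -- harmless, since a fixed point lies in all late balls.
  have h1 := ae_eventually_notMem (μ := μ)
    (ne_top_of_le_ne_top hsum (ENNReal.tsum_le_tsum fun n => (h.step n).measure))
  have h2 : ∀ᵐ x ∂μ, ∀ n, ∀ᶠ y in nhds x, (S n).p y = (S n).p x ∧ (S n).b y = (S n).b x :=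
    ae_all_iff.2 fun n => (h.admissible n).locConst
  filter_upwards [h1, h2] with x hx1 hx2 hxΩ
  obtain ⟨N, hN⟩ := exists_nat_gt ‖x‖
  filter_upwards [hx1, Filter.eventually_ge_atTop N] with n hn hNn hneg
  by_contra! hlt
  refine hn ⟨⟨hxΩ, mem_ball_zero_iff.2 (hN.trans_le (by exact_mod_cast hNn))⟩, hx2 n, hneg, hlt⟩

end IsRun

end Limit

/-! ### The almost classical solution -/

theorem proposition4p2 {X : Type*} [NormedAddCommGroup X] [NormedSpace ℝ X]
    [FiniteDimensional ℝ X] [MeasurableSpace X] [BorelSpace X]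
    (hdim : 2 ≤ Module.finrank ℝ X)
    (μ : Measure X) [μ.IsAddHaarMeasure]
    (Ω : Set X) (hΩ : IsOpen Ω)
    (F : ℝ → X → (X →L[ℝ] ℝ) → ℝ)
    (hF : ContinuousOn (fun q : ℝ × X × (X →L[ℝ] ℝ) => F q.1 q.2.1 q.2.2)
      (univ ×ˢ Ω ×ˢ univ))
    (hA : ∀ x ∈ Ω, F 0 x 0 ≤ 0)
    (hB : ∀ K : Set X, IsCompact K → K ⊆ Ω →
      ∃ α > (0 : ℝ), ∃ M > (0 : ℝ), ∀ x ∈ K, ∀ r ∈ Icc (0 : ℝ) α,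
        ∀ p : X →L[ℝ] ℝ, M ≤ ‖p‖ → 0 < F r x p)
    (ε : ℝ) (hε : 0 < ε) :
    ∃ u : X → ℝ,
      (∀ x ∈ closure Ω, 0 ≤ u x) ∧
      (∀ x ∈ closure Ω, |u x| ≤ ε) ∧
      IsAlmostClassicalSolution μ Ω F (fun _ => 0) u ∧
      Differentiable ℝ (Ω.indicator u) := by
  -- The norm of `X` is arbitrary while the game needs orthogonality, so it is played in a Euclidean
  -- space linearly isomorphic to the dual.
  set V := EuclideanSpace ℝ (Fin (Module.finrank ℝ X)) with hV
  have hVdim : Module.finrank ℝ V = Module.finrank ℝ (X →L[ℝ] ℝ) := by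
    rw [finrank_euclideanSpace_fin, ← (LinearMap.toContinuousLinearMap (𝕜 := ℝ) (E := X)
      (F' := ℝ)).finrank_eq, Module.finrank_linearMap_self]
  let e : V ≃L[ℝ] X →L[ℝ] ℝ := ContinuousLinearEquiv.ofFinrankEq hVdim
  obtain ⟨φ, hφ, hφ'⟩ := exists_size_function hΩ hB hε
  have hφ0 : ∀ x ∈ Ω, 0 < φ x := fun x hx => (hφ' x hx).1
  choose dir hdir1 hdir using exists_unit_inner_eq_zero (V := V)
    (by rw [finrank_euclideanSpace_fin]; exact hdim)
  set d : ℕ → ℝ := fun j => (1 / 2) ^ j with hd_def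
  have hd : ∀ j, 0 < d j := fun j => by positivity
  have hd0 : Filter.Tendsto d Filter.atTop (nhds 0) :=
    tendsto_pow_atTop_nhds_zero_of_lt_one (by norm_num) (by norm_num)
  obtain ⟨len, hlen⟩ := exists_short_step V d hd
  obtain ⟨J, hJ, hJ', hblock⟩ := exists_block_levels len
  set T : V →L[ℝ] X →L[ℝ] ℝ := e.toContinuousLinearMap with hT_def
  have hT : AntilipschitzWith _ T := e.antilipschitz
  obtain ⟨S, s, h⟩ := exists_isRun (V := V) μ hΩ hF hA hφ hφ0 (T := T) hT.injective hdir1 hd J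
  set u : X → ℝ := fun x => ⨆ n, (S n).u x with hu_def
  have hlim := h.tendsto_u hφ0
  have hu_out : ∀ x ∉ Ω, u x = 0 := fun x hx => by
    simp [hu_def, (h.admissible _).eq_zero x hx]
  have hu_nonneg : ∀ x, 0 ≤ u x := fun x => ge_of_tendsto' (hlim x) fun n => h.u_nonneg n x
  have hu_le : ∀ x ∈ Ω, u x ≤ φ x := fun x hx =>
    le_of_tendsto' (hlim x) fun n => h.u_le_size hφ0 n hx
  have hp : ∀ x ∈ Ω, ∃ R : ℝ, ∀ n, ‖(S n).p x‖ ≤ R := fun x hx =>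
    h.exists_norm_p_le hφ0 hT (fun x hx => (hφ' x hx).2.2.2) hx
  have hderiv : ∀ x ∈ Ω, Filter.Tendsto (fun n => fderiv ℝ (S n).u x) Filter.atTop
      (nhds (fderiv ℝ u x)) ∧ DifferentiableAt ℝ u x := by
    intro x hx
    obtain ⟨R, hR⟩ := hp x hx
    obtain ⟨L, hL⟩ := h.exists_tendsto_fderiv hdir hd hd0 hJ hJ' hR
    have h1 := h.hasFDerivAt hφ0 hd0 hJ' hL
    rw [← h1.fderiv] at hL
    exact ⟨hL, h1.differentiableAt⟩
  have hdiff : Differentiable ℝ u := by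
    intro x
    by_cases hx : x ∈ Ω
    · exact (hderiv x hx).2
    -- At points outside `Ω` the bound `φ y ≤ dist y x ^ 2` makes `u` quadratically small.
    · refine (hasFDerivAt_zero_of_abs_le_dist_sq fun y => ?_).differentiableAt
      rw [hu_out x hx, sub_zero, abs_of_nonneg (hu_nonneg y)]
      by_cases hy : y ∈ Ω
      · exact (hu_le y hy).trans ((hφ' y hy).2.2.1 x hx)
      · rw [hu_out y hy]
        positivity
  have hcont : ∀ x ∈ Ω, ContinuousAt (fun q : ℝ × X × (X →L[ℝ] ℝ) => F q.1 q.2.1 q.2.2)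
      (u x, x, fderiv ℝ u x) := fun x hx =>
    hF.continuousAt ((isOpen_univ.prod (hΩ.prod isOpen_univ)).mem_nhds
      ⟨mem_univ _, hx, mem_univ _⟩)
  have hsub : ∀ x ∈ Ω, F (u x) x (fderiv ℝ u x) ≤ 0 := by
    intro x hx
    have h1 : Filter.Tendsto (fun n => ((S n).u x, x, fderiv ℝ (S n).u x)) Filter.atTop
        (nhds (u x, x, fderiv ℝ u x)) :=
      (hlim x).prodMk_nhds (tendsto_const_nhds.prodMk_nhds (hderiv x hx).1)
    exact le_of_tendsto' ((hcont x hx).tendsto.comp h1) fun n => (h.admissible n).sub x hx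
  refine ⟨u, fun x _ => hu_nonneg x, fun x _ => ?_,
    ⟨hdiff.continuous.continuousOn, fun x hx => ?_, fun x _ => hdiff x, hsub, ?_⟩, ?_⟩
  · rw [abs_of_nonneg (hu_nonneg x)]
    by_cases hx : x ∈ Ω
    · exact (hu_le x hx).trans (hφ' x hx).2.1
    · rw [hu_out x hx]
      exact hε.le
  · rw [hΩ.frontier_eq] at hx
    exact hu_out x hx.2
  · filter_upwards [h.ae_eventually_long_step] with x hlong hx
    by_contra hne
    have hneg : F (u x) x (fderiv ℝ u x) < 0 := lt_of_le_of_ne (hsub x hx) hne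
    obtain ⟨κ, hκ, hball⟩ := Metric.eventually_nhds_iff_ball.1
      ((hcont x hx).eventually_lt_const hneg)
    have hstep0 : Filter.Tendsto (fun n => 8 * d (J n) * ‖T‖) Filter.atTop (nhds 0) := by
      simpa using ((hd0.comp hJ').const_mul 8).mul_const ‖T‖
    have hall : ∀ᶠ n in Filter.atTop, 2 * d (J n) ≤ |s n x| := by
      filter_upwards [hlong hx, hstep0.eventually_lt_const (half_pos hκ),
        (hlim x) (Metric.ball_mem_nhds _ hκ),
        (hderiv x hx).1 (Metric.ball_mem_nhds _ (half_pos hκ))] with n hn h1 h2 h3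
      refine hn fun t ht => hball ((S n).u x, x, _) ?_
      rw [Metric.mem_ball, Prod.dist_eq, Prod.dist_eq, max_lt_iff, max_lt_iff]
      refine ⟨h2, by simpa using hκ, ?_⟩
      have h4 : ‖fderiv ℝ (S n).u x - fderiv ℝ u x‖ < κ / 2 := by
        rw [← dist_eq_norm]
        exact h3
      have h5 : ‖t • (S n).direction T dir (J n) x‖ ≤ 8 * d (J n) * ‖T‖ := by
        have h6 := T.le_opNorm (dir ((S n).p x - gameCenter ((S n).b x) (J n + 1)))
        rw [hdir1, mul_one] at h6
        rw [norm_smul]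
        exact mul_le_mul (abs_le.2 ht) h6 (norm_nonneg _) (by have := hd (J n); positivity)
      simp only
      rw [dist_eq_norm, add_sub_right_comm]
      linarith [norm_add_le (fderiv ℝ (S n).u x - fderiv ℝ u x)
        (t • (S n).direction T dir (J n) x)]
    obtain ⟨N, hN⟩ := hall.exists_forall_of_atTop
    obtain ⟨R, hR⟩ := hp x hx
    -- The level `k` bounds the play, as `exists_short_step` requires, and its block starts at `a ≥
    -- k ≥ N`, where all steps are already long.
    obtain ⟨k, hk⟩ := exists_nat_ge (max R N)
    obtain ⟨a, hka, ha⟩ := hblock k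
    obtain ⟨n, han, hnl, hshort⟩ := hlen J _ _ (h.isPlay hdir x) hJ k a
      (fun n => (hR n).trans ((le_max_left _ _).trans hk)) ha
    have hNk : N ≤ k := by exact_mod_cast (le_max_right _ _).trans hk
    have h7 := hN n (hNk.trans (hka.trans han))
    rw [ha n han hnl] at h7
    simp only [(h.step n).next_p x, add_sub_cancel_left, norm_smul, hdir1, mul_one,
      Real.norm_eq_abs] at hshort
    linarith
  · have : Ω.indicator u = u := by
      ext x
      by_cases hx : x ∈ Ω
      · rw [indicator_of_mem hx]
      · rw [indicator_of_notMem hx, hu_out x hx]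
    rwa [this]
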